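/- All operads are symmetric operads in $\mathbb{Z}$-modules, described by modules $\mathcal P(I)$ for finite sets $I$, functorial in bijections, with a unit and bilinear partial compositions $\circ_j:\mathcal P(J)\otimes\mathcal P(I)\to\mathcal P((J\setminus\{j\})\sqcup I)$, $j\in J$. **The operad $\operatorname{APE}$.** For a finite set $I$, let $\operatorname{APE}(I)$ be the free $\mathbb{Z}$-module on the set of planar rooted trees with vertex set $I$ (rooted trees in which the edges entering each vertex are linearly ordered from left to right). A vertex with $k$ entering edges has $k+1$ angles (the gaps before, between and after these edges), and the set $\operatorname{Angles}(S)$ of all angles of a tree $S$ is totally ordered from left to right: first the leftmost angle of the root, then the angles of the first subtree above the root, then the second angle of the root, then the angles of the second subtree, and so on. For trees $T$ on $J$ and $S$ on $I$ and $j\in J$, set $$T\circ_j S=\sum_f T\circ_j^f S ,$$ where $f$ runs over the weakly increasing maps from the left-to-right ordered set of edges of $T$ entering $j$ to $\operatorname{Angles}(S)$, and $T\circ_j^f S$ is the tree obtained by substituting $S$ for the vertex $j$ of $T$ and grafting each edge of $T$ that entered $j$ in the angle of $S$ given by $f$ (edges sent to the same angle keep their order). The unit is the one-vertex tree. **The operad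 $\operatorname{Brace}$.** Let $\operatorname{Brace}$ be the quotient of the free operad on generators $C_n$ with $n+1$ entries, one for each $n\ge 1$ (with no symmetry; the corresponding operation is written $\{x_1\mid x_2,\dots,x_{n+1}\}$, and $\{x\mid\ \}=x$ by convention), by the operadic ideal generated by the relations, for all $n,m\ge 1$, $$\{\{z\mid x_1,\dots,x_n\}\mid y_1,\dots,y_m\}=\sum\{z\mid Y_0,\{x_1\mid Y_1\},Y_2,\{x_2\mid Y_3\},Y_4,\dots,Y_{2n-2},\{x_n\mid Y_{2n-1}\},Y_{2n}\},$$ where the sum is over the partitions of the ordered set $\{y_1,\dots,y_m\}$ into successive, possibly empty, intervals $Y_0\sqcup Y_1\sqcup\dots\sqcup Y_{2n}$. **Proposition.** $\operatorname{APE}$ and $\operatorname{Brace}$ are operads, and there is an isomorphism of operads $\operatorname{Brace}\to\operatorname{APE}$ which, for every $n\ge1$, sends the class of the generator $C_n$ to the corolla $\operatorname{Corl}_n$ with $n$ leaves, whose root carries the label of the first entry of $C_n$ and whose leaves carry, from left to right, the labels of the other entries. -/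

import Mathlib

/-! ### Symmetric operads in `ℤ`-modules, with partial compositions, indexed by finite sets -/

/-- The data of an operad in abelian groups: a module `P(I)` for every finite set `I`,
relabellings along bijections, a unit, and bilinear partial compositions
`p ∘_j q ∈ P((J ∖ {j}) ⊔ I)` for `p ∈ P(J)`, `j ∈ J`, `q ∈ P(I)`.
The axioms are stated in `OperadData.IsOperad`. -/
structure OperadData where
  obj : (I : Type) → [Finite I] → Type
  [addCommGroup : ∀ (I : Type) [Finite I], AddCommGroup (obj I)]
  map : ∀ {I J : Type} [Finite I] [Finite J], I ≃ J → obj I →+ obj J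
  one : obj Unit
  comp : ∀ {J I : Type} [Finite J] [Finite I] (j : J),
    obj J →+ obj I →+ obj ({x : J // x ≠ j} ⊕ I)

attribute [instance] OperadData.addCommGroup

namespace OperadData

/-- The bijection `(J ∖ {j}) ⊔ I ≃ (J' ∖ {σ j}) ⊔ I'` induced by `σ : J ≃ J'` and
`τ : I ≃ I'`. -/
def congrEquiv {J J' I I' : Type} (σ : J ≃ J') (τ : I ≃ I') (j : J) :
    {x : J // x ≠ j} ⊕ I ≃ {x : J' // x ≠ σ j} ⊕ I' :=
  Equiv.sumCongr (σ.subtypeEquiv fun _ => (not_congr σ.injective.eq_iff).symm) τ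

/-- The bijection `({*} ∖ {*}) ⊔ I ≃ I`. -/
def leftUnitEquiv (I : Type) : {x : Unit // x ≠ ()} ⊕ I ≃ I where
  toFun
    | .inl x => absurd rfl x.2
    | .inr i => i
  invFun i := .inr i
  left_inv := by
    rintro (⟨x, hx⟩ | i)
    · exact absurd rfl hx
    · rfl
  right_inv _ := rfl

open Classical in
/-- The bijection `(J ∖ {j}) ⊔ {*} ≃ J` sending `*` to `j`. -/
noncomputable def rightUnitEquiv {J : Type} (j : J) : {x : J // x ≠ j} ⊕ Unit ≃ J where
  toFun
    | .inl x => x.1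
    | .inr _ => j
  invFun x := if h : x = j then .inr () else .inl ⟨x, h⟩
  left_inv := by
    rintro (⟨x, hx⟩ | ⟨⟩)
    · simp [hx]
    · simp
  right_inv x := by
    by_cases h : x = j
    · simp [h]
    · simp [h]

/-- The bijection `(((J ∖ {j}) ⊔ I) ∖ {i}) ⊔ K ≃ (J ∖ {j}) ⊔ ((I ∖ {i}) ⊔ K)`. -/
def seqEquiv {J I : Type} (K : Type) (j : J) (i : I) :
    {x : {x : J // x ≠ j} ⊕ I // x ≠ Sum.inr i} ⊕ K ≃
      {x : J // x ≠ j} ⊕ ({x : I // x ≠ i} ⊕ K) where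
  toFun
    | .inl ⟨.inl x, _⟩ => .inl x
    | .inl ⟨.inr y, h⟩ => .inr (.inl ⟨y, fun e => h (congrArg Sum.inr e)⟩)
    | .inr k => .inr (.inr k)
  invFun
    | .inl x => .inl ⟨.inl x, Sum.inl_ne_inr⟩
    | .inr (.inl y) => .inl ⟨.inr y.1, fun e => y.2 (Sum.inr.inj e)⟩
    | .inr (.inr k) => .inr k
  left_inv := by rintro (⟨_ | _, _⟩ | _) <;> rfl
  right_inv := by rintro (_ | _ | _) <;> rfl

/-- The bijection `(((J ∖ {j}) ⊔ I) ∖ {j'}) ⊔ K ≃ (((J ∖ {j'}) ⊔ K) ∖ {j}) ⊔ I` for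
`j ≠ j'` in `J`. -/
def parEquiv {J : Type} (I K : Type) {j j' : J} (h : j' ≠ j) :
    {x : {x : J // x ≠ j} ⊕ I // x ≠ Sum.inl ⟨j', h⟩} ⊕ K ≃
      {x : {x : J // x ≠ j'} ⊕ K // x ≠ Sum.inl ⟨j, h.symm⟩} ⊕ I where
  toFun
    | .inl ⟨.inl x, hx⟩ =>
        .inl ⟨.inl ⟨x.1, fun e => hx (congrArg Sum.inl (Subtype.ext e))⟩,
          fun e => x.2 (congrArg Subtype.val (Sum.inl.inj e))⟩
    | .inl ⟨.inr i, _⟩ => .inr i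
    | .inr k => .inl ⟨.inr k, Sum.inr_ne_inl⟩
  invFun
    | .inl ⟨.inl x, hx⟩ =>
        .inl ⟨.inl ⟨x.1, fun e => hx (congrArg Sum.inl (Subtype.ext e))⟩,
          fun e => x.2 (congrArg Subtype.val (Sum.inl.inj e))⟩
    | .inl ⟨.inr k, _⟩ => .inr k
    | .inr i => .inl ⟨.inr i, Sum.inr_ne_inl⟩
  left_inv := by rintro (⟨_ | _, _⟩ | _) <;> rfl
  right_inv := by rintro (⟨_ | _, _⟩ | _) <;> rfl

/-- The axioms of a symmetric operad: functoriality, equivariance, units, sequential and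
parallel associativity. -/
structure IsOperad (P : OperadData) : Prop where
  map_refl : ∀ (I : Type) [Finite I] (p : P.obj I), P.map (Equiv.refl I) p = p
  map_trans : ∀ {I J K : Type} [Finite I] [Finite J] [Finite K] (e : I ≃ J) (f : J ≃ K)
    (p : P.obj I), P.map (e.trans f) p = P.map f (P.map e p)
  comp_equivariant : ∀ {J J' I I' : Type} [Finite J] [Finite J'] [Finite I] [Finite I']
    (σ : J ≃ J') (τ : I ≃ I') (j : J) (p : P.obj J) (q : P.obj I),
    P.comp (σ j) (P.map σ p) (P.map τ q) = P.map (congrEquiv σ τ j) (P.comp j p q)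
  one_comp : ∀ {I : Type} [Finite I] (q : P.obj I),
    P.map (leftUnitEquiv I) (P.comp () P.one q) = q
  comp_one : ∀ {J : Type} [Finite J] (j : J) (p : P.obj J),
    P.map (rightUnitEquiv j) (P.comp j p P.one) = p
  comp_seq : ∀ {J I K : Type} [Finite J] [Finite I] [Finite K] (j : J) (i : I)
    (p : P.obj J) (q : P.obj I) (r : P.obj K),
    P.map (seqEquiv K j i) (P.comp (Sum.inr i) (P.comp j p q) r) =
      P.comp j p (P.comp i q r)
  comp_par : ∀ {J I K : Type} [Finite J] [Finite I] [Finite K] {j j' : J} (h : j' ≠ j)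
    (p : P.obj J) (q : P.obj I) (r : P.obj K),
    P.map (parEquiv I K h) (P.comp (Sum.inl ⟨j', h⟩) (P.comp j p q) r) =
      P.comp (Sum.inl ⟨j, h.symm⟩) (P.comp j' p r) q

/-- Isomorphisms of operads. -/
structure Iso (P Q : OperadData) where
  equiv : ∀ (I : Type) [Finite I], P.obj I ≃+ Q.obj I
  equiv_map : ∀ {I J : Type} [Finite I] [Finite J] (e : I ≃ J) (p : P.obj I),
    equiv J (P.map e p) = Q.map e (equiv I p)
  equiv_one : equiv Unit P.one = Q.one
  equiv_comp : ∀ {J I : Type} [Finite J] [Finite I] (j : J) (p : P.obj J) (q : P.obj I),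
    equiv _ (P.comp j p q) = Q.comp j (equiv J p) (equiv I q)

/-- Two-sided operadic ideals. -/
structure Ideal (P : OperadData) where
  carrier : ∀ (I : Type) [Finite I], AddSubgroup (P.obj I)
  map_mem : ∀ {I J : Type} [Finite I] [Finite J] (e : I ≃ J) {p : P.obj I},
    p ∈ carrier I → P.map e p ∈ carrier J
  comp_mem_left : ∀ {J I : Type} [Finite J] [Finite I] (j : J) {p : P.obj J} (q : P.obj I),
    p ∈ carrier J → P.comp j p q ∈ carrier ({x : J // x ≠ j} ⊕ I)
  comp_mem_right : ∀ {J I : Type} [Finite J] [Finite I] (j : J) (p : P.obj J) {q : P.obj I},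
    q ∈ carrier I → P.comp j p q ∈ carrier ({x : J // x ≠ j} ⊕ I)

/-- Membership in the ideal generated by a family of sets `R(I) ⊆ P(I)`. -/
inductive SpanMem (P : OperadData) (R : ∀ (I : Type) [Finite I], Set (P.obj I)) :
    ∀ (I : Type) [Finite I], P.obj I → Prop
  | of {I : Type} [Finite I] (p : P.obj I) : p ∈ R I → SpanMem P R I p
  | zero (I : Type) [Finite I] : SpanMem P R I 0
  | add {I : Type} [Finite I] (p q : P.obj I) :
      SpanMem P R I p → SpanMem P R I q → SpanMem P R I (p + q)
  | neg {I : Type} [Finite I] (p : P.obj I) : SpanMem P R I p → SpanMem P R I (-p)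
  | map {I J : Type} [Finite I] [Finite J] (e : I ≃ J) (p : P.obj I) :
      SpanMem P R I p → SpanMem P R J (P.map e p)
  | comp_left {J I : Type} [Finite J] [Finite I] (j : J) (p : P.obj J) (q : P.obj I) :
      SpanMem P R J p → SpanMem P R ({x : J // x ≠ j} ⊕ I) (P.comp j p q)
  | comp_right {J I : Type} [Finite J] [Finite I] (j : J) (p : P.obj J) (q : P.obj I) :
      SpanMem P R I q → SpanMem P R ({x : J // x ≠ j} ⊕ I) (P.comp j p q)

/-- The ideal generated by a family of sets `R(I) ⊆ P(I)`. -/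
def Ideal.span (P : OperadData) (R : ∀ (I : Type) [Finite I], Set (P.obj I)) : P.Ideal where
  carrier I _ :=
    { carrier := {p | SpanMem P R I p}
      zero_mem' := SpanMem.zero I
      add_mem' := fun {p q} hp hq => SpanMem.add p q hp hq
      neg_mem' := fun {p} hp => SpanMem.neg p hp }
  map_mem {_ _} _ _ e {p} hp := SpanMem.map e p hp
  comp_mem_left {_ _} _ _ j {p} q hp := SpanMem.comp_left j p q hp
  comp_mem_right {_ _} _ _ j p {q} hq := SpanMem.comp_right j p q hq

/-- The quotient of an operad by an ideal. -/
def quotient (P : OperadData) (N : P.Ideal) : OperadData where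
  obj I _ := P.obj I ⧸ N.carrier I
  addCommGroup I _ := inferInstanceAs (AddCommGroup (P.obj I ⧸ N.carrier I))
  map {I J} _ _ e := QuotientAddGroup.map (N.carrier I) (N.carrier J) (P.map e)
    fun _ hp => N.map_mem e hp
  one := QuotientAddGroup.mk' (N.carrier Unit) P.one
  comp {J I} _ _ j := QuotientAddGroup.lift (N.carrier J)
    (AddMonoidHom.mk'
      (fun p => QuotientAddGroup.map (N.carrier I) (N.carrier ({x : J // x ≠ j} ⊕ I))
        (P.comp j p) fun _ hq => N.comp_mem_right j p hq)
      (fun p p' => by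
        refine QuotientAddGroup.addMonoidHom_ext _ (AddMonoidHom.ext fun q => ?_)
        refine congrArg (QuotientAddGroup.mk' _) ?_
        rw [map_add]
        rfl))
    (fun p hp => by
      refine QuotientAddGroup.addMonoidHom_ext _ (AddMonoidHom.ext fun q => ?_)
      exact (QuotientAddGroup.eq_zero_iff _).2 (N.comp_mem_left j q hp))

/-- The projection to the quotient. -/
def toQuotient (P : OperadData) (N : P.Ideal) (I : Type) [Finite I] :
    P.obj I →+ (P.quotient N).obj I :=
  QuotientAddGroup.mk' (N.carrier I)

end OperadData

/-! ### Labellings in which every element of the finite set is used exactly once -/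

/-- Every element of `V` occurs exactly once in the list. -/
def Exhausts {V : Type} (l : List V) : Prop := l.Nodup ∧ ∀ v, v ∈ l

theorem Exhausts.perm {V : Type} {l l' : List V} (h : Exhausts l) (p : l'.Perm l) :
    Exhausts l' :=
  ⟨p.nodup_iff.2 h.1, fun v => p.mem_iff.2 (h.2 v)⟩

theorem Exhausts.map {V W : Type} {l : List V} (h : Exhausts l) (e : V ≃ W) :
    Exhausts (l.map e) :=
  ⟨h.1.map e.injective, fun w => List.mem_map.2 ⟨e.symm w, h.2 _, e.apply_symm_apply w⟩⟩

/-- The list obtained from a list in `J` by replacing `j` by a list in `I`. -/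
def replaceAt {J I : Type} [DecidableEq J] (j : J) (l' : List I) (l : List J) :
    List ({x : J // x ≠ j} ⊕ I) :=
  l.flatMap fun x => if h : x = j then l'.map Sum.inr else [Sum.inl ⟨x, h⟩]

theorem Exhausts.replaceAt {J I : Type} [DecidableEq J] {l : List J} {l' : List I}
    (h : Exhausts l) (h' : Exhausts l') (j : J) : Exhausts (replaceAt j l' l) := by
  unfold _root_.replaceAt
  refine ⟨List.nodup_flatMap.2 ⟨fun x _ => ?_, h.1.imp fun {x y} hxy => ?_⟩, ?_⟩
  · split_ifs with hx
    · exact h'.1.map Sum.inr_injective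
    · simp
  · intro a ha hb
    dsimp only at ha hb
    split_ifs at ha hb with h1 h2 h3
    · exact hxy (h1.trans h2.symm)
    · simp at ha hb
      obtain ⟨i, _, rfl⟩ := ha
      cases hb
    · simp at ha hb
      obtain ⟨i, _, rfl⟩ := hb
      cases ha
    · simp at ha hb
      subst ha
      simp at hb
      exact hxy hb
  · rintro (⟨x, hx⟩ | i)
    · exact List.mem_flatMap.2 ⟨x, h.2 x, by simp [hx]⟩
    · exact List.mem_flatMap.2 ⟨j, h.2 j, by simp [h'.2 i]⟩

/-! ### The free operad on a family of generators -/

/-- Formal composites of the operations `g`, with `ar g` entries, in variables from `V`. -/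
inductive OpTerm {G : Type} (ar : G → ℕ) (V : Type) : Type
  | var : V → OpTerm ar V
  | op : (g : G) → (Fin (ar g) → OpTerm ar V) → OpTerm ar V

namespace OpTerm

variable {G : Type} {ar : G → ℕ}

/-- The variables of a term, from left to right. -/
def vars {V : Type} : OpTerm ar V → List V
  | var v => [v]
  | op _ ts => (List.ofFn fun i => (ts i).vars).flatten

/-- Substitution of terms for the variables. -/
def subst {V W : Type} (f : V → OpTerm ar W) : OpTerm ar V → OpTerm ar W
  | var v => f v
  | op g ts => op g fun i => (ts i).subst f

theorem vars_subst {V W : Type} (f : V → OpTerm ar W) (t : OpTerm ar V) :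
    (t.subst f).vars = t.vars.flatMap fun v => (f v).vars := by
  induction t with
  | var v => simp [subst, vars]
  | op g ts ih =>
    simp only [subst, vars, ih]
    rw [List.flatMap_def, List.map_flatten, List.flatten_flatten, List.map_map, List.map_ofFn]
    congr 2

/-- Renaming of the variables. -/
def rename {V W : Type} (f : V → W) (t : OpTerm ar V) : OpTerm ar W := t.subst fun v => var (f v)

theorem vars_rename {V W : Type} (f : V → W) (t : OpTerm ar V) :
    (t.rename f).vars = t.vars.map f := by
  rw [rename, vars_subst]
  simp [vars, List.map_eq_flatMap]

open Classical in
/-- Substitution of the term `s` for the variable `j` of `t`. -/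
noncomputable def insertAt {J I : Type} (j : J) (t : OpTerm ar J) (s : OpTerm ar I) :
    OpTerm ar ({x : J // x ≠ j} ⊕ I) :=
  t.subst fun x => if h : x = j then s.rename Sum.inr else var (Sum.inl ⟨x, h⟩)

open Classical in
theorem vars_insertAt {J I : Type} (j : J) (t : OpTerm ar J) (s : OpTerm ar I) :
    (t.insertAt j s).vars = replaceAt j s.vars t.vars := by
  rw [insertAt, vars_subst, replaceAt]
  congr 1
  funext x
  split_ifs
  · exact vars_rename _ _
  · rfl

end OpTerm

/-- Multilinear terms: every element of `I` occurs exactly once as a variable. -/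
def MultilinearTerm {G : Type} (ar : G → ℕ) (I : Type) : Type :=
  {t : OpTerm ar I // Exhausts t.vars}

/-- The free (symmetric, `ℤ`-linear) operad on generators `g` with `ar g` entries, without
symmetries: the free `ℤ`-module on the multilinear terms, composed by substitution. -/
noncomputable def FreeOperad {G : Type} (ar : G → ℕ) : OperadData where
  obj I _ := FreeAbelianGroup (MultilinearTerm ar I)
  map e := FreeAbelianGroup.map fun t =>
    ⟨t.1.rename e, by rw [OpTerm.vars_rename]; exact t.2.map e⟩
  one := FreeAbelianGroup.of ⟨OpTerm.var (), by simp [Exhausts, OpTerm.vars]⟩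
  comp j := FreeAbelianGroup.lift fun t => FreeAbelianGroup.lift fun s =>
    FreeAbelianGroup.of ⟨t.1.insertAt j s.1, by
      classical
      rw [OpTerm.vars_insertAt]
      exact t.2.replaceAt s.2 j⟩

/-- The generator `g`, as an element of the free operad on the set `{0, …, ar g - 1}`. -/
noncomputable def FreeOperad.gen {G : Type} (ar : G → ℕ) (g : G) :
    (FreeOperad ar).obj (Fin (ar g)) :=
  FreeAbelianGroup.of ⟨OpTerm.op g OpTerm.var, by
    have : (OpTerm.op g OpTerm.var : OpTerm ar (Fin (ar g))).vars = List.finRange (ar g) := by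
      simp only [OpTerm.vars, List.ofFn_eq_map]
      rw [← List.flatMap_def]
      simp
    rw [this]
    exact ⟨List.nodup_finRange _, List.mem_finRange⟩⟩

/-! ### The operad Brace -/

/-- The arity of the generators: `C_n`, `n ≥ 1`, has `n + 1` entries. -/
def braceArity (n : ℕ+) : ℕ := (n : ℕ) + 1

/-- The operation `{t₀ ∣ t₁, …, t_k}`, equal to `C_k(t₀, t₁, …, t_k)` if `k ≥ 1` and, by
convention, to `t₀` if `k = 0`. -/
def brace {V : Type} (t₀ : OpTerm braceArity V) : List (OpTerm braceArity V) → OpTerm braceArity V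
  | [] => t₀
  | t :: ts => OpTerm.op (⟨(t :: ts).length, Nat.succ_pos _⟩ : ℕ+) (t₀ :: t :: ts).get

theorem vars_brace {V : Type} (t₀ : OpTerm braceArity V) (l : List (OpTerm braceArity V)) :
    (brace t₀ l).vars = t₀.vars ++ l.flatMap OpTerm.vars := by
  cases l with
  | nil => simp [brace]
  | cons t ts =>
    have : (brace t₀ (t :: ts)).vars =
        (List.ofFn fun i : Fin (t₀ :: t :: ts).length =>
          ((t₀ :: t :: ts).get i).vars).flatten := rfl
    have h : (List.ofFn fun i => ((t₀ :: t :: ts).get i).vars) =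
        (List.ofFn (t₀ :: t :: ts).get).map OpTerm.vars := by
      rw [List.map_ofFn]
      rfl
    rw [this, h, List.ofFn_get]
    simp [List.flatMap_def]

/-- The variables `z, x_1, …, x_n, y_1, …, y_m` of the brace relations. -/
abbrev BraceVar (n m : ℕ) : Type := Unit ⊕ (Fin n ⊕ Fin m)

namespace BraceRelation

variable {n m : ℕ}

/-- The variable `z`. -/
def z : OpTerm braceArity (BraceVar n m) := OpTerm.var (Sum.inl ())

/-- The variable `x_{i+1}`. -/
def x (i : Fin n) : OpTerm braceArity (BraceVar n m) := OpTerm.var (Sum.inr (Sum.inl i))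

/-- The variable `y_{i+1}`. -/
def y (i : Fin m) : OpTerm braceArity (BraceVar n m) := OpTerm.var (Sum.inr (Sum.inr i))

/-- `{{z ∣ x_1, …, x_n} ∣ y_1, …, y_m}`. -/
def lhs (n m : ℕ) : OpTerm braceArity (BraceVar n m) :=
  brace (brace z ((List.finRange n).map x)) ((List.finRange m).map y)

/-- A decomposition of the ordered set `{y_1, …, y_m}` into successive, possibly empty,
intervals `Y_0, Y_1, …, Y_{2n}` is given by the weakly increasing map that sends each `y` to the
index of its interval. -/
abbrev Decomposition (n m : ℕ) : Type := {c : Fin m → Fin (2 * n + 1) // Monotone c}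

/-- The sequence `Y_k`. -/
def Y (c : Decomposition n m) (k : ℕ) : List (OpTerm braceArity (BraceVar n m)) :=
  ((List.finRange m).filter fun i => (c.1 i : ℕ) = k).map y

/-- `{z ∣ Y_0, {x_1 ∣ Y_1}, Y_2, {x_2 ∣ Y_3}, Y_4, …, Y_{2n-2}, {x_n ∣ Y_{2n-1}}, Y_{2n}}`. -/
def rhs (c : Decomposition n m) : OpTerm braceArity (BraceVar n m) :=
  brace z (Y c 0 ++ (List.finRange n).flatMap fun i =>
    brace (x i) (Y c (2 * i + 1)) :: Y c (2 * i + 2))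

theorem exhausts_lhs (n m : ℕ) : Exhausts (lhs n m).vars := by
  have h : (lhs n m).vars = Sum.inl () :: ((List.finRange n).map (fun i => Sum.inr (Sum.inl i)) ++
      (List.finRange m).map (fun i => Sum.inr (Sum.inr i))) := by
    simp [lhs, vars_brace, z, x, y, OpTerm.vars, List.flatMap_map, ← List.map_eq_flatMap]
  rw [h]
  refine ⟨?_, ?_⟩
  · rw [List.nodup_cons, List.nodup_append]
    refine ⟨by simp, (List.nodup_finRange n).map (fun a b h => by simpa using h),
      (List.nodup_finRange m).map (fun a b h => by simpa using h), ?_⟩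
    simp
  · rintro (⟨⟩ | i | i) <;> simp

theorem vars_Y (c : Decomposition n m) (k : ℕ) :
    (Y c k).flatMap OpTerm.vars =
      ((List.finRange m).filter fun i => (c.1 i : ℕ) = k).map fun i => Sum.inr (Sum.inr i) := by
  simp [Y, y, OpTerm.vars, List.flatMap_map, ← List.map_eq_flatMap]

theorem mem_vars_Y (c : Decomposition n m) (k : ℕ) (v : BraceVar n m) :
    v ∈ (Y c k).flatMap OpTerm.vars ↔
      ∃ i, (c.1 i : ℕ) = k ∧ Sum.inr (Sum.inr i) = v := by
  rw [vars_Y]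
  simp

theorem nodup_vars_Y (c : Decomposition n m) (k : ℕ) :
    ((Y c k).flatMap OpTerm.vars).Nodup := by
  rw [vars_Y]
  exact ((List.nodup_finRange m).filter _).map fun a b h => by simpa using h

theorem vars_rhs (c : Decomposition n m) : (rhs c).vars =
    Sum.inl () :: ((Y c 0).flatMap OpTerm.vars ++ (List.finRange n).flatMap fun i =>
      (Sum.inr (Sum.inl i) : BraceVar n m) :: ((Y c (2 * i + 1)).flatMap OpTerm.vars ++
        (Y c (2 * i + 2)).flatMap OpTerm.vars)) := by
  simp [rhs, vars_brace, z, x, OpTerm.vars, List.flatMap_assoc]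

theorem exhausts_rhs (c : Decomposition n m) : Exhausts (rhs c).vars := by
  rw [vars_rhs]
  have hmem := mem_vars_Y c
  have hnd := nodup_vars_Y c
  generalize hA : (fun k => (Y c k).flatMap OpTerm.vars) = A
  have hA' : ∀ k, (Y c k).flatMap OpTerm.vars = A k := fun k => by rw [← hA]
  simp only [hA'] at hmem hnd ⊢
  refine ⟨?_, ?_⟩
  · rw [List.nodup_cons, List.nodup_append, List.nodup_flatMap]
    refine ⟨?_, hnd 0, ⟨fun i _ => ?_, ?_⟩, ?_⟩
    · simp [hmem]
    · rw [List.nodup_cons, List.nodup_append]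
      refine ⟨by simp [hmem], hnd _, hnd _, ?_⟩
      intro a ha b hb hab
      rw [hmem] at ha hb
      obtain ⟨p, hp, rfl⟩ := ha
      obtain ⟨q, hq, rfl⟩ := hb
      simp only [Sum.inr.injEq] at hab
      subst hab
      omega
    · refine (List.nodup_finRange n).imp fun {i j} hij => ?_
      have hij' : (i : ℕ) ≠ j := fun h => hij (Fin.ext h)
      intro a ha hb
      simp only [List.mem_cons, List.mem_append, hmem] at ha hb
      rcases ha with rfl | ⟨p, hp, rfl⟩ | ⟨p, hp, rfl⟩ <;>
        rcases hb with hb | ⟨q, hq, hb⟩ | ⟨q, hq, hb⟩ <;>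
        simp only [Sum.inr.injEq, Sum.inl.injEq, reduceCtorEq] at hb <;>
        subst hb <;> first | exact hij rfl | omega
    · intro a ha b hb hab
      subst hab
      rw [hmem] at ha
      obtain ⟨p, hp, rfl⟩ := ha
      simp only [List.mem_flatMap, List.mem_cons, List.mem_append, hmem] at hb
      obtain ⟨i, _, hb | ⟨q, hq, hb⟩ | ⟨q, hq, hb⟩⟩ := hb <;>
        simp only [Sum.inr.injEq, reduceCtorEq] at hb <;> subst hb <;> omega
  · rintro (⟨⟩ | i | j)
    · simp
    · simp
    · simp only [List.mem_cons, List.mem_append, List.mem_flatMap, reduceCtorEq, false_or]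
      simp only [hmem]
      have hlt := (c.1 j).2
      rcases Nat.eq_zero_or_pos (c.1 j : ℕ) with h0 | h0
      · exact Or.inl ⟨j, h0, rfl⟩
      · refine Or.inr ⟨⟨((c.1 j : ℕ) - 1) / 2, by omega⟩, List.mem_finRange _, Or.inr ?_⟩
        rcases Nat.even_or_odd' (c.1 j : ℕ) with ⟨k, hk | hk⟩
        · exact Or.inr ⟨j, by dsimp only; omega, rfl⟩
        · exact Or.inl ⟨j, by dsimp only; omega, rfl⟩

open Classical in
/-- The difference of the two sides of the brace relation with `n` and `m` arguments. -/
noncomputable def relator (n m : ℕ) : (FreeOperad braceArity).obj (BraceVar n m) :=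
  FreeAbelianGroup.of (⟨lhs n m, exhausts_lhs n m⟩ : MultilinearTerm braceArity (BraceVar n m)) -
    ∑ c : Decomposition n m,
      FreeAbelianGroup.of
        (⟨rhs c, exhausts_rhs c⟩ : MultilinearTerm braceArity (BraceVar n m))

/-- The set of all brace relators (`n, m ≥ 1`). -/
inductive Relators : ∀ (I : Type) [Finite I], (FreeOperad braceArity).obj I → Prop
  | mk (n m : ℕ+) : Relators (BraceVar n m) (relator n m)

end BraceRelation

/-- The operadic ideal generated by the brace relations. -/
noncomputable def braceIdeal : (FreeOperad braceArity).Ideal :=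
  OperadData.Ideal.span _ fun I _ => {p | BraceRelation.Relators I p}

/-- The operad Brace: the free operad on the `C_n`, `n ≥ 1`, modulo the brace relations. -/
noncomputable def Brace : OperadData := (FreeOperad braceArity).quotient braceIdeal

/-- The class of the generator `C_n` in Brace, on the set `{0, …, n}`. -/
noncomputable def Brace.C (n : ℕ+) : Brace.obj (Fin (n + 1)) :=
  (FreeOperad braceArity).toQuotient braceIdeal _ (FreeOperad.gen braceArity n)

/-! ### The operad APE of planar rooted trees -/

/-- Planar rooted trees with vertices labelled by `V`: the label of the root and the list, from
left to right, of the subtrees attached to the edges entering the root. -/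
inductive PlanarTree (V : Type) : Type
  | node : V → List (PlanarTree V) → PlanarTree V

namespace PlanarTree

mutual
/-- The list of the labels of the vertices. -/
def labels {V : Type} : PlanarTree V → List V
  | node v ts => v :: labelsForest ts
/-- The list of the labels of the vertices of a forest. -/
def labelsForest {V : Type} : List (PlanarTree V) → List V
  | [] => []
  | t :: ts => labels t ++ labelsForest ts
end

mutual
/-- Relabelling. -/
def map {V W : Type} (f : V → W) : PlanarTree V → PlanarTree W
  | node v ts => node (f v) (mapForest f ts)
/-- Relabelling of a forest. -/
def mapForest {V W : Type} (f : V → W) : List (PlanarTree V) → List (PlanarTree W)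
  | [] => []
  | t :: ts => map f t :: mapForest f ts
end

mutual
/-- The number of angles: a vertex with `k` entering edges has `k + 1` angles. -/
def numAngles {V : Type} : PlanarTree V → ℕ
  | node _ ts => 1 + numAnglesForest ts
/-- The number of angles to the right of the leftmost angle of a vertex, where `ts` are the
subtrees above this vertex: after each subtree comes one more angle of the vertex. -/
def numAnglesForest {V : Type} : List (PlanarTree V) → ℕ
  | [] => 0
  | t :: ts => numAngles t + 1 + numAnglesForest ts
end

mutual
/-- Number the angles of a tree by `0, 1, 2, …` from left to right: first the leftmost angle of
the root, then all angles of the first subtree, then the second angle of the root, then all angles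
of the second subtree, and so on. `graft F t` is the tree obtained by grafting, for every `a`, the
forest `F a` in the angle number `a` of `t`. -/
def graft {V : Type} (F : ℕ → List (PlanarTree V)) : PlanarTree V → PlanarTree V
  | node v ts => node v (F 0 ++ graftForest (fun a => F (a + 1)) ts)
/-- The part of `graft` that concerns the angles to the right of the leftmost angle of a vertex
with subtrees `ts`. -/
def graftForest {V : Type} (F : ℕ → List (PlanarTree V)) :
    List (PlanarTree V) → List (PlanarTree V)
  | [] => []
  | t :: ts => graft F t :: (F (numAngles t) ++
      graftForest (fun a => F (a + numAngles t + 1)) ts)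
end

/-- The sequence of those trees in `ts` which are sent to the angle `a`, where `fs` lists the
angles to which the successive trees of `ts` are sent. -/
def fiber {V : Type} (ts : List (PlanarTree V)) (fs : List ℕ) (a : ℕ) : List (PlanarTree V) :=
  ((ts.zip fs).filter fun p => p.2 = a).map Prod.fst

mutual
/-- The number of edges of `T` entering the vertex `j`. -/
def inDegree {J : Type} [DecidableEq J] (j : J) : PlanarTree J → ℕ
  | node x ts => if x = j then ts.length else inDegreeForest j ts
/-- The number of edges entering the vertex `j` of a forest. -/
def inDegreeForest {J : Type} [DecidableEq J] (j : J) : List (PlanarTree J) → ℕ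
  | [] => 0
  | t :: ts => inDegree j t + inDegreeForest j ts
end

mutual
/-- Substitution of the tree `S` for the vertex `j` of a tree `T`: the edges of `T` that enter
`j`, from left to right, are grafted in the angles of `S` whose numbers are listed in `fs`. -/
def insertAt {J I : Type} [DecidableEq J] (j : J) (S : PlanarTree I) (fs : List ℕ) :
    PlanarTree J → PlanarTree ({x : J // x ≠ j} ⊕ I)
  | node x ts =>
      if h : x = j then graft (fiber (insertForest j S fs ts) fs) (S.map Sum.inr)
      else node (Sum.inl ⟨x, h⟩) (insertForest j S fs ts)
/-- Substitution of the tree `S` for the vertex `j` of a forest. -/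
def insertForest {J I : Type} [DecidableEq J] (j : J) (S : PlanarTree I) (fs : List ℕ) :
    List (PlanarTree J) → List (PlanarTree ({x : J // x ≠ j} ⊕ I))
  | [] => []
  | t :: ts => insertAt j S fs t :: insertForest j S fs ts
end

theorem labelsForest_eq {V : Type} (ts : List (PlanarTree V)) :
    labelsForest ts = ts.flatMap labels := by
  induction ts with
  | nil => rfl
  | cons t ts ih => rw [labelsForest, ih, List.flatMap_cons]

mutual
theorem labels_map {V W : Type} (f : V → W) : ∀ t : PlanarTree V,
    (t.map f).labels = t.labels.map f
  | node v ts => by simp [map, labels, labelsForest_map f ts]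
theorem labelsForest_map {V W : Type} (f : V → W) : ∀ ts : List (PlanarTree V),
    labelsForest (mapForest f ts) = (labelsForest ts).map f
  | [] => by simp [mapForest, labelsForest]
  | t :: ts => by simp [mapForest, labelsForest, labels_map f t, labelsForest_map f ts]
end

mutual
theorem numAngles_map {V W : Type} (f : V → W) : ∀ t : PlanarTree V,
    (t.map f).numAngles = t.numAngles
  | node v ts => by simp [map, numAngles, numAnglesForest_map f ts]
theorem numAnglesForest_map {V W : Type} (f : V → W) : ∀ ts : List (PlanarTree V),
    numAnglesForest (mapForest f ts) = numAnglesForest ts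
  | [] => by simp [mapForest, numAnglesForest]
  | t :: ts => by simp [mapForest, numAnglesForest, numAngles_map f t, numAnglesForest_map f ts]
end

theorem range_add_flatMap {α : Type} (F : ℕ → List α) (m n : ℕ) :
    (List.range (m + n)).flatMap F =
      (List.range m).flatMap F ++ (List.range n).flatMap fun a => F (a + m) := by
  rw [List.range_add, List.flatMap_append, List.flatMap_map]
  simp [add_comm]

mutual
theorem labels_graft {V : Type} : ∀ (F : ℕ → List (PlanarTree V)) (t : PlanarTree V),
    (graft F t).labels.Perm
      (t.labels ++ (List.range t.numAngles).flatMap fun a => labelsForest (F a))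
  | F, node v ts => by
    have h := labelsForest_graft (fun a => F (a + 1)) ts
    rw [graft, labels, labels, numAngles, range_add_flatMap]
    simp only [labelsForest_eq, List.flatMap_append, List.range_one, List.flatMap_cons,
      List.flatMap_nil, List.append_nil, List.cons_append, List.perm_cons] at h ⊢
    refine (h.append_left _).trans ?_
    rw [← List.append_assoc, ← List.append_assoc]
    exact List.perm_append_comm.append_right _
theorem labelsForest_graft {V : Type} : ∀ (F : ℕ → List (PlanarTree V))
    (ts : List (PlanarTree V)), (labelsForest (graftForest F ts)).Perm
      (labelsForest ts ++ (List.range (numAnglesForest ts)).flatMap fun a => labelsForest (F a))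
  | F, [] => by simp [graftForest, labelsForest, numAnglesForest]
  | F, t :: ts => by
    have h1 := labels_graft F t
    have h2 := labelsForest_graft (fun a => F (a + numAngles t + 1)) ts
    rw [graftForest, labelsForest, labelsForest, numAnglesForest, range_add_flatMap,
      range_add_flatMap]
    simp only [labelsForest_eq, List.flatMap_append, List.range_one, List.flatMap_cons,
      List.flatMap_nil, List.append_nil, zero_add, ← add_assoc] at h1 h2 ⊢
    classical
    rw [List.perm_iff_count] at h1 h2 ⊢
    intro a
    have h1 := h1 a
    have h2 := h2 a
    simp only [List.count_append] at h1 h2 ⊢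
    omega
end

theorem flatMap_filter_perm {α : Type} (l : List (α × ℕ)) (N : ℕ) :
    ((List.range N).flatMap fun a => l.filter fun p => p.2 = a).Perm
      (l.filter fun p => p.2 < N) := by
  induction N with
  | zero => simp
  | succ N ih =>
    rw [List.range_succ, List.flatMap_append]
    simp only [List.flatMap_cons, List.flatMap_nil, List.append_nil]
    refine (ih.append_right _).trans ?_
    have h := List.filter_append_perm (fun p : α × ℕ => decide (p.2 < N))
      (l.filter fun p => p.2 < N + 1)
    refine List.Perm.trans (List.Perm.of_eq ?_) h
    rw [List.filter_filter, List.filter_filter]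
    congr 1 <;> refine List.filter_congr fun p _ => ?_ <;>
      simp only [← Bool.decide_and, ← decide_not, decide_eq_decide] <;> omega

theorem flatMap_fiber_perm {V : Type} (ts : List (PlanarTree V)) (fs : List ℕ) (N : ℕ)
    (hl : fs.length = ts.length) (hN : ∀ a ∈ fs, a < N) :
    ((List.range N).flatMap fun a => labelsForest (fiber ts fs a)).Perm (labelsForest ts) := by
  have h := ((flatMap_filter_perm (ts.zip fs) N).map Prod.fst).flatMap_right labels
  rw [List.filter_eq_self.2 (fun p hp => by simpa using hN _ (List.of_mem_zip hp).2),
    List.map_fst_zip (by omega)] at h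
  simpa [labelsForest_eq, fiber, List.map_flatMap, List.flatMap_assoc] using h

mutual
theorem inDegree_eq_zero {J : Type} [DecidableEq J] (j : J) : ∀ t : PlanarTree J,
    j ∉ t.labels → inDegree j t = 0
  | node x ts, h => by
    simp only [labels, List.mem_cons, not_or] at h
    rw [inDegree, if_neg (Ne.symm h.1), inDegreeForest_eq_zero j ts h.2]
theorem inDegreeForest_eq_zero {J : Type} [DecidableEq J] (j : J) :
    ∀ ts : List (PlanarTree J), j ∉ labelsForest ts → inDegreeForest j ts = 0
  | [], _ => rfl
  | t :: ts, h => by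
    simp only [labelsForest, List.mem_append, not_or] at h
    rw [inDegreeForest, inDegree_eq_zero j t h.1, inDegreeForest_eq_zero j ts h.2]
end

theorem length_insertForest {J I : Type} [DecidableEq J] (j : J) (S : PlanarTree I)
    (fs : List ℕ) (ts : List (PlanarTree J)) :
    (insertForest j S fs ts).length = ts.length := by
  induction ts with
  | nil => rfl
  | cons t ts ih => simp [insertForest, ih]

mutual
theorem labels_insertAt {J I : Type} [DecidableEq J] (j : J) (S : PlanarTree I) (fs : List ℕ)
    (hfs : ∀ a ∈ fs, a < S.numAngles) : ∀ T : PlanarTree J, T.labels.Nodup →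
    (j ∈ T.labels → fs.length = inDegree j T) →
    (insertAt j S fs T).labels.Perm (replaceAt j S.labels T.labels)
  | node x ts, hnd, hlen => by
    simp only [labels, List.nodup_cons] at hnd
    have ih := labelsForest_insertForest j S fs hfs ts hnd.2
    unfold replaceAt at ih ⊢
    by_cases hx : x = j
    · subst hx
      have hl : fs.length = ts.length := by simpa [labels, inDegree] using hlen
      have h1 := labels_graft (fiber (insertForest x S fs ts) fs) (S.map Sum.inr)
      have h2 := flatMap_fiber_perm (insertForest x S fs ts) fs S.numAngles
        (by rw [length_insertForest, hl]) hfs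
      rw [labels_map, numAngles_map] at h1
      rw [insertAt, dif_pos rfl, labels, List.flatMap_cons, dif_pos rfl]
      exact h1.trans ((h2.trans (ih fun h => absurd h hnd.1)).append_left _)
    · rw [insertAt, dif_neg hx, labels, labels, List.flatMap_cons, dif_neg hx]
      refine (ih fun h => ?_).cons _
      rw [hlen (by simp [labels, h]), inDegree, if_neg hx]
theorem labelsForest_insertForest {J I : Type} [DecidableEq J] (j : J) (S : PlanarTree I)
    (fs : List ℕ) (hfs : ∀ a ∈ fs, a < S.numAngles) : ∀ ts : List (PlanarTree J),
    (labelsForest ts).Nodup → (j ∈ labelsForest ts → fs.length = inDegreeForest j ts) →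
    (labelsForest (insertForest j S fs ts)).Perm (replaceAt j S.labels (labelsForest ts))
  | [], _, _ => by simp [insertForest, labelsForest, replaceAt]
  | t :: ts, hnd, hlen => by
    simp only [labelsForest, List.nodup_append] at hnd
    have h1 := labels_insertAt j S fs hfs t hnd.1 fun h => by
      rw [hlen (by simp [labelsForest, h]), inDegreeForest,
        inDegreeForest_eq_zero j ts fun h' => hnd.2.2 j h j h' rfl, add_zero]
    have h2 := labelsForest_insertForest j S fs hfs ts hnd.2.1 fun h => by
      rw [hlen (by simp [labelsForest, h]), inDegreeForest,
        inDegree_eq_zero j t fun h' => hnd.2.2 j h' j h rfl, zero_add]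
    rw [insertForest, labelsForest, labelsForest]
    unfold replaceAt at h1 h2 ⊢
    rw [List.flatMap_append]
    exact h1.append h2
end

end PlanarTree

/-- Planar rooted trees on the vertex set `I`: every element of `I` labels exactly one vertex. -/
def PlanarTreeOn (I : Type) : Type := {t : PlanarTree I // Exhausts t.labels}

namespace PlanarTreeOn

/-- Relabelling along a bijection. -/
def map {I J : Type} (e : I ≃ J) (t : PlanarTreeOn I) : PlanarTreeOn J :=
  ⟨t.1.map e, by rw [PlanarTree.labels_map]; exact t.2.map e⟩

/-- The one-vertex tree. -/
def one : PlanarTreeOn Unit :=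
  ⟨PlanarTree.node () [], by
    simp [PlanarTree.labels, PlanarTree.labelsForest, Exhausts]⟩

open Classical in
/-- The weakly increasing maps from the set of edges of `T` entering `j` to the set of angles
of `S`, both ordered from left to right. -/
abbrev GraftingMap {J I : Type} (j : J) (T : PlanarTreeOn J) (S : PlanarTreeOn I) : Type :=
  {f : Fin (T.1.inDegree j) → Fin S.1.numAngles // Monotone f}

open Classical in
/-- The tree `T ∘_j^f S`. -/
noncomputable def compMap {J I : Type} (j : J) (T : PlanarTreeOn J) (S : PlanarTreeOn I)
    (f : GraftingMap j T S) : PlanarTreeOn ({x : J // x ≠ j} ⊕ I) :=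
  ⟨PlanarTree.insertAt j S.1 (List.ofFn fun k => (f.1 k : ℕ)) T.1, by
    refine (T.2.replaceAt S.2 j).perm (PlanarTree.labels_insertAt j S.1 _ ?_ T.1 T.2.1 ?_)
    · intro a ha
      obtain ⟨k, rfl⟩ := (List.mem_ofFn' _ _).1 ha
      exact (f.1 k).2
    · simp⟩

/-- The corolla with `n` leaves: the root is `0` and the leaves are `1, …, n` from left to
right. -/
def corolla (n : ℕ) : PlanarTreeOn (Fin (n + 1)) :=
  ⟨PlanarTree.node 0 ((List.finRange n).map fun i => PlanarTree.node i.succ []), by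
    have h : (PlanarTree.node 0
        ((List.finRange n).map fun i => PlanarTree.node i.succ [])).labels =
        List.finRange (n + 1) := by
      rw [PlanarTree.labels, PlanarTree.labelsForest_eq, List.flatMap_map, List.finRange_succ]
      simp [PlanarTree.labels, PlanarTree.labelsForest, List.map_eq_flatMap]
    rw [h]
    exact ⟨List.nodup_finRange _, List.mem_finRange⟩⟩

end PlanarTreeOn

open Classical in
/-- The operad APE: `APE(I)` is the free `ℤ`-module on the planar rooted trees on `I`, and
`T ∘_j S` is the sum of the trees `T ∘_j^f S` over all weakly increasing maps `f` from the edges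
entering `j` to the angles of `S`. -/
noncomputable def APE : OperadData where
  obj I _ := FreeAbelianGroup (PlanarTreeOn I)
  map e := FreeAbelianGroup.map (PlanarTreeOn.map e)
  one := FreeAbelianGroup.of PlanarTreeOn.one
  comp j := FreeAbelianGroup.lift fun T => FreeAbelianGroup.lift fun S =>
    ∑ f : PlanarTreeOn.GraftingMap j T S, FreeAbelianGroup.of (PlanarTreeOn.compMap j T S f)

/-- The corolla `Corl_n` as an element of APE. -/
noncomputable def APE.Corl (n : ℕ) : APE.obj (Fin (n + 1)) :=
  FreeAbelianGroup.of (PlanarTreeOn.corolla n)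

-- Grafting a sequence of trees, in order, into the angles of a tree is a brace operation `insT` on
-- sums of planar trees. All coefficients involved are natural numbers, so these sums are multisets.
-- The brace identity `insT_insT` holds because both sides list the same graftings: each sequence of
-- trees is split around each subtree and treated recursively.
--
-- Replacing every vertex `v` of a tree by a sum `f v`, with the forest above `v` grafted into it by
-- `insT`, defines a simultaneous substitution `tsub`, which commutes with `insT` (`insT_tsub`). A
-- weakly increasing map from edges to angles is a decomposition of the sequence of edges into
-- successive intervals, one per angle. Hence the partial composition of APE is the substitution of
-- `S` at the single label `j` (`bind_insertAt`).
--
-- A brace term is evaluated by reading `C_n` as `insT`. By `eval_subst` this gives a homomorphism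
-- `evalHom` from the free operad to APE. It kills the brace relators: a corolla with `n` leaves has
-- `2n + 1` angles, and a decomposition into `Y_0, …, Y_{2n}` is a weakly increasing map to these
-- angles (`evalApp_relator`). It is surjective, since each tree is the value of an iterated brace
-- with variables in first position (`eval_toTerm`). The axioms of APE thus follow from those of the
-- free operad, without being checked on trees.
--
-- For injectivity on Brace, a brace relation read from left to right rewrites any term whose first
-- entry is itself a brace, and the terms that no such rewriting changes are exactly those of trees.
-- A weight counting the first entry twice decreases, so every multilinear term is congruent to a
-- sum of tree terms (`of_sub_toFree_mem`). As evaluation is the identity on tree terms, its kernel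
-- is the brace ideal (`mem_braceIdeal_iff`).
--
-- Rewriting occurs inside subterms, which use only some of the variables. It is therefore done in
-- the free group on all terms, modulo substitution instances of the ideal (`substClosure`).
-- Projecting to multilinear terms leads back into the ideal (`projApp_mem`), because a multilinear
-- simultaneous substitution is a succession of partial compositions and a relabelling.

/-! ### Cutting a list in two, and grafting forests into the angles of a tree -/

/-- The sum of `Φ a b` over the decompositions `l = a ++ b`. -/
def cut {α β : Type} : List α → (List α → List α → Multiset β) → Multiset β
  | [], Φ => Φ [] []
  | y :: ys, Φ => Φ [] (y :: ys) + cut ys fun a b => Φ (y :: a) b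

section Cut

variable {α β γ : Type}

theorem cut_congr (l : List α) {Φ Ψ : List α → List α → Multiset β} (h : ∀ a b, Φ a b = Ψ a b) :
    cut l Φ = cut l Ψ := by
  rw [show Φ = Ψ from funext₂ h]

theorem Multiset.bind_congr' (m : Multiset α) {f g : α → Multiset β} (h : ∀ a, f a = g a) :
    m.bind f = m.bind g := by
  rw [show f = g from funext h]

theorem cut_bind (l : List α) (Φ : List α → List α → Multiset β) (g : β → Multiset γ) :
    (cut l Φ).bind g = cut l fun a b => (Φ a b).bind g := by
  induction l generalizing Φ with
  | nil => rfl
  | cons y ys ih => rw [cut, cut, Multiset.add_bind, ih]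

theorem bind_cut (m : Multiset γ) (l : List α) (Φ : γ → List α → List α → Multiset β) :
    (m.bind fun x => cut l (Φ x)) = cut l fun a b => m.bind fun x => Φ x a b := by
  induction l generalizing Φ with
  | nil => rfl
  | cons y ys ih =>
    simp only [cut]
    rw [Multiset.bind_add, ih]

theorem cut_add (l : List α) (Φ Ψ : List α → List α → Multiset β) :
    (cut l fun a b => Φ a b + Ψ a b) = cut l Φ + cut l Ψ := by
  induction l generalizing Φ Ψ with
  | nil => rfl
  | cons y ys ih =>
    simp only [cut]
    rw [ih, add_add_add_comm]

theorem cut_zero (l : List α) : (cut l fun _ _ => (0 : Multiset β)) = 0 := by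
  induction l with
  | nil => rfl
  | cons y ys ih => simp only [cut, ih, add_zero]

theorem cut_comm (l : List α) (l' : List γ)
    (Φ : List α → List α → List γ → List γ → Multiset β) :
    (cut l fun a b => cut l' fun c d => Φ a b c d) =
      cut l' fun c d => cut l fun a b => Φ a b c d := by
  induction l generalizing Φ with
  | nil => rfl
  | cons y ys ih =>
    simp only [cut]
    rw [cut_add, ih]

theorem cut_assoc (l : List α) (Φ : List α → List α → List α → Multiset β) :
    (cut l fun a bc => cut bc fun b c => Φ a b c) =
      cut l fun ab c => cut ab fun a b => Φ a b c := by
  induction l generalizing Φ with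
  | nil => rfl
  | cons y ys ih =>
    simp only [cut]
    rw [cut_add, ih, add_assoc]

/-- The cut falls either to the left or to the right of `t`. -/
theorem cut_append_cons (l : List α) (t : α) (l' : List α)
    (Φ : List α → List α → Multiset β) :
    cut (l ++ t :: l') Φ = (cut l fun a b => Φ a (b ++ t :: l')) +
      cut l' fun a b => Φ (l ++ t :: a) b := by
  induction l generalizing Φ with
  | nil => rfl
  | cons y ys ih =>
    simp only [List.cons_append, cut]
    rw [ih, add_assoc]

theorem mem_cut {l : List α} {Φ : List α → List α → Multiset β} {x : β} :
    x ∈ cut l Φ ↔ ∃ a b, a ++ b = l ∧ x ∈ Φ a b := by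
  induction l generalizing Φ with
  | nil => simp [cut]
  | cons y ys ih =>
    rw [cut, Multiset.mem_add, ih]
    constructor
    · rintro (h | ⟨a, b, rfl, h⟩)
      · exact ⟨[], _, rfl, h⟩
      · exact ⟨y :: a, b, rfl, h⟩
    · rintro ⟨_ | ⟨z, a⟩, b, hab, h⟩
      · exact Or.inl (by simpa using hab ▸ h)
      · simp only [List.cons_append, List.cons.injEq] at hab
        obtain ⟨rfl, rfl⟩ := hab
        exact Or.inr ⟨a, b, rfl, h⟩

end Cut

namespace PlanarTree

variable {V W : Type}

mutual
/-- The trees obtained by grafting the trees of a list, in this order from left to right, in the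
angles of a tree. -/
def insT : PlanarTree V → List (PlanarTree V) → Multiset (PlanarTree V)
  | node v ts, ys => (insF ts ys).bind fun us => {node v us}
/-- The forests obtained by grafting the trees of a list, in this order from left to right, in the
angles of a vertex with subtrees `ts` and in those of the subtrees. -/
def insF : List (PlanarTree V) → List (PlanarTree V) → Multiset (List (PlanarTree V))
  | [], ys => {ys}
  | t :: ts, ys => cut ys fun a bc => cut bc fun b c =>
      (insT t b).bind fun t' => (insF ts c).bind fun us => {a ++ t' :: us}
end

/-- The angles are, from left to right, those belonging to `A`, those of `t`, and those belonging to
`B`; the two root angles adjacent to `t` are counted with `A` and `B`. An ordered grafting therefore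
splits `H` into three intervals. -/
theorem insF_append_cons (A : List (PlanarTree V)) (t : PlanarTree V) (B H : List (PlanarTree V)) :
    insF (A ++ t :: B) H = cut H fun h₁ h => cut h fun h₂ h₃ =>
      (insF A h₁).bind fun A' => (insT t h₂).bind fun t' => (insF B h₃).bind fun B' =>
        {A' ++ t' :: B'} := by
  induction A generalizing H with
  | nil => simp only [List.nil_append, insF, Multiset.singleton_bind]
  | cons s A ih =>
    simp only [List.cons_append, insF, ih, cut_bind, bind_cut, Multiset.bind_assoc,
      Multiset.singleton_bind, List.append_assoc]
    conv_rhs =>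
      enter [2, h₁, h]
      rw [cut_comm]
      enter [2, a, b]
      rw [cut_comm]
    rw [← cut_assoc]
    refine cut_congr _ fun a bc => ?_
    rw [← cut_assoc]

/-- A root tree of a grafted forest comes either from `G` or from `H`, so a cut of the result is the
same as a cut of `G` together with a cut of `H`. -/
theorem insF_cut {β : Type} (G H : List (PlanarTree V))
    (Φ : List (PlanarTree V) → List (PlanarTree V) → Multiset β) :
    ((insF G H).bind fun U => cut U Φ) = cut G fun g₁ g₂ => cut H fun h₁ h₂ =>
      (insF g₁ h₁).bind fun A => (insF g₂ h₂).bind fun B => Φ A B := by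
  induction G generalizing H Φ with
  | nil => simp only [insF, cut, Multiset.singleton_bind]
  | cons t G ih =>
    simp only [cut, insF, cut_bind, bind_cut, Multiset.bind_assoc, Multiset.singleton_bind,
      cut_append_cons, Multiset.bind_add, cut_add, ih]
    congr 1
    · conv_lhs =>
        enter [2, a, bc]
        rw [cut_comm]
      rw [← cut_assoc]
    · conv_lhs =>
        enter [2, a, bc]
        rw [cut_comm]
      rw [cut_comm]
      refine cut_congr _ fun g₁ g₂ => ?_
      rw [← cut_assoc]
      refine cut_congr _ fun a bc => ?_
      rw [← cut_assoc]

mutual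
-- This is the brace identity. A tree of `ys` lands either in an original angle or inside a tree of
-- `xs` already grafted; grafting `ys` among the `xs` first records the same choices.
theorem insT_insT : ∀ (z : PlanarTree V) (xs ys : List (PlanarTree V)),
    ((insT z xs).bind fun t => insT t ys) = (insF xs ys).bind fun us => insT z us
  | node v ts, xs, ys => by
    have h := congrArg (fun m => m.bind fun us => ({node v us} : Multiset (PlanarTree V)))
      (insF_insF ts xs ys)
    simpa only [insT, Multiset.bind_assoc, Multiset.singleton_bind] using h
theorem insF_insF : ∀ (zs xs ys : List (PlanarTree V)),
    ((insF zs xs).bind fun us => insF us ys) = (insF xs ys).bind fun us => insF zs us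
  | [], xs, ys => by
    simp only [insF, Multiset.singleton_bind]
    rw [Multiset.bind_singleton, Multiset.map_id']
  | t :: ts, xs, ys => by
    simp only [insF, insF_cut, cut_bind, bind_cut, Multiset.bind_assoc, Multiset.singleton_bind,
      insF_append_cons]
    refine cut_congr _ fun a bc => ?_
    -- Both sides now run over the splittings of `xs` into `a, b, c` and of `ys` into `h₁, h₂, h₃`;
    -- only the order of the sums differs.
    rw [cut_comm]
    refine cut_congr _ fun h₁ h => cut_congr _ fun b c => cut_congr _ fun h₂ h₃ => ?_
    have h₁' := insT_insT t b h₂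
    have h₂' := insF_insF ts c h₃
    -- For fixed splittings the sums above `t` and `ts` are independent, so the identities for `t`
    -- and for `ts` can be applied separately after interchanging sums.
    have key : ∀ Φ : PlanarTree V → List (PlanarTree V) → Multiset (List (PlanarTree V)),
        ((insT t b).bind fun x => (insF ts c).bind fun us => (insT x h₂).bind fun t' =>
          (insF us h₃).bind fun B => Φ t' B) =
        (insF b h₂).bind fun A => (insF c h₃).bind fun B => (insT t A).bind fun t' =>
          (insF ts B).bind fun us => Φ t' us := fun Φ => by
      have e₁ : ∀ x, ((insF ts c).bind fun us => (insT x h₂).bind fun t' =>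
          (insF us h₃).bind fun B => Φ t' B) = (insT x h₂).bind fun t' =>
            ((insF c h₃).bind fun B => insF ts B).bind fun us => Φ t' us := fun x => by
        rw [Multiset.bind_bind]
        simp only [← h₂', Multiset.bind_assoc]
      have e₂ : ∀ A, ((insF c h₃).bind fun B => (insT t A).bind fun t' =>
          (insF ts B).bind fun us => Φ t' us) = (insT t A).bind fun t' =>
            ((insF c h₃).bind fun B => insF ts B).bind fun us => Φ t' us := fun A => by
        rw [Multiset.bind_bind]
        simp only [Multiset.bind_assoc]
      simp only [e₁, e₂]
      rw [← Multiset.bind_assoc, ← Multiset.bind_assoc, h₁']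
    rw [← Multiset.bind_congr' (insF a h₁) fun x => key fun t' B => {x ++ t' :: B}]
    exact (Multiset.bind_congr' _ fun x => Multiset.bind_bind _ _).trans (Multiset.bind_bind _ _)
end

end PlanarTree

namespace PlanarTree

/-! ### Substitution of sums of trees for the labels of a tree -/

variable {V W : Type}

mutual
theorem insT_nil : ∀ t : PlanarTree V, insT t [] = {t}
  | node v ts => by rw [insT, insF_nil ts, Multiset.singleton_bind]
theorem insF_nil : ∀ ts : List (PlanarTree V), insF ts [] = {ts}
  | [] => rfl
  | t :: ts => by
    simp only [insF, cut, insT_nil t, insF_nil ts, Multiset.singleton_bind, List.nil_append]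
end

theorem insT_leaf (v : V) (ys : List (PlanarTree V)) : insT (node v []) ys = {node v ys} := by
  rw [insT, insF, Multiset.singleton_bind]

mutual
/-- Substitution of sums of trees for the labels of a tree. -/
def tsub (f : V → Multiset (PlanarTree W)) : PlanarTree V → Multiset (PlanarTree W)
  | node v ts => (f v).bind fun s => (fsub f ts).bind fun us => insT s us
/-- Substitution of sums of trees for the labels of a forest. -/
def fsub (f : V → Multiset (PlanarTree W)) : List (PlanarTree V) → Multiset (List (PlanarTree W))
  | [] => {[]}
  | t :: ts => (tsub f t).bind fun s => (fsub f ts).bind fun us => {s :: us}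
end

theorem fsub_append (f : V → Multiset (PlanarTree W)) (a b : List (PlanarTree V)) :
    fsub f (a ++ b) = (fsub f a).bind fun a' => (fsub f b).bind fun b' => {a' ++ b'} := by
  induction a with
  | nil =>
    simp only [List.nil_append, fsub, Multiset.singleton_bind]
    rw [Multiset.bind_singleton, Multiset.map_id']
  | cons t a ih =>
    simp only [List.cons_append, fsub, ih, Multiset.bind_assoc, Multiset.singleton_bind]

/-- Substitution acts tree by tree and keeps the number of trees, so cuts before and after it
correspond. -/
theorem fsub_cut {β : Type} (f : V → Multiset (PlanarTree W)) (l : List (PlanarTree V))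
    (Φ : List (PlanarTree W) → List (PlanarTree W) → Multiset β) :
    ((fsub f l).bind fun us => cut us Φ) =
      cut l fun a b => (fsub f a).bind fun a' => (fsub f b).bind fun b' => Φ a' b' := by
  induction l generalizing Φ with
  | nil => simp only [fsub, cut, Multiset.singleton_bind]
  | cons t l ih =>
    simp only [fsub, cut, ih, Multiset.bind_assoc, Multiset.singleton_bind, Multiset.bind_add,
      bind_cut]

mutual
-- Substitution is a morphism for the brace operation. At a root replaced by `s`, the left side
-- grafts into `s` the forest obtained by grafting `ys'` into `ts'`, and the right side grafts `ts'`
-- and then `ys'`; `insT_insT` identifies them.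
theorem insT_tsub (f : V → Multiset (PlanarTree W)) : ∀ (t : PlanarTree V)
    (ys : List (PlanarTree V)), ((insT t ys).bind fun t => tsub f t) =
      (tsub f t).bind fun t' => (fsub f ys).bind fun ys' => insT t' ys'
  | node v ts, ys => by
    simp only [insT, tsub, Multiset.bind_assoc, Multiset.singleton_bind]
    rw [Multiset.bind_bind]
    refine Multiset.bind_congr' _ fun s => ?_
    have h := congrArg (fun m => m.bind fun us => insT s us) (insF_fsub f ts ys)
    simp only [Multiset.bind_assoc] at h
    rw [h]
    refine Multiset.bind_congr' _ fun us => ?_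
    rw [Multiset.bind_bind (insT s us)]
    refine Multiset.bind_congr' _ fun ys' => ?_
    rw [← insT_insT]
theorem insF_fsub (f : V → Multiset (PlanarTree W)) : ∀ (ts ys : List (PlanarTree V)),
    ((insF ts ys).bind fun us => fsub f us) =
      (fsub f ts).bind fun ts' => (fsub f ys).bind fun ys' => insF ts' ys'
  | [], ys => by
    simp only [insF, fsub, Multiset.singleton_bind]
    rw [Multiset.bind_singleton, Multiset.map_id']
  | t :: ts, ys => by
    simp only [insF, fsub, fsub_cut, fsub_append, cut_bind, bind_cut, Multiset.bind_assoc,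
      Multiset.singleton_bind]
    refine cut_congr _ fun a bc => cut_congr _ fun b c => ?_
    have key : ∀ Φ : PlanarTree W → List (PlanarTree W) → Multiset (List (PlanarTree W)),
        ((insT t b).bind fun x => (insF ts c).bind fun us => (tsub f x).bind fun x' =>
          (fsub f us).bind fun us' => Φ x' us') =
        (tsub f t).bind fun t' => (fsub f ts).bind fun ts' => (fsub f b).bind fun b' =>
          (fsub f c).bind fun c' => (insT t' b').bind fun x' => (insF ts' c').bind fun us' =>
            Φ x' us' := fun Φ => by
      have h₁ := insT_tsub f t b
      have h₂ := insF_fsub f ts c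
      have e₁ : ∀ x, ((insF ts c).bind fun us => (tsub f x).bind fun x' =>
          (fsub f us).bind fun us' => Φ x' us') = (tsub f x).bind fun x' =>
          ((insF ts c).bind fun us => fsub f us).bind fun us' => Φ x' us' := fun x => by
        rw [Multiset.bind_bind]
        simp only [Multiset.bind_assoc]
      simp only [e₁]
      rw [← Multiset.bind_assoc, h₁, h₂]
      simp only [Multiset.bind_assoc]
      refine Multiset.bind_congr' _ fun t' => ?_
      rw [Multiset.bind_bind (fsub f ts)]
      refine Multiset.bind_congr' _ fun b' => ?_
      rw [Multiset.bind_bind (insT t' b')]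
      refine Multiset.bind_congr' _ fun ts' => ?_
      rw [Multiset.bind_bind (insT t' b')]
    trans (fsub f a).bind fun a' => (insT t b).bind fun x => (insF ts c).bind fun us =>
        (tsub f x).bind fun x' => (fsub f us).bind fun us' => {a' ++ x' :: us'}
    · exact (Multiset.bind_congr' _ fun x => Multiset.bind_bind _ _).trans (Multiset.bind_bind _ _)
    · simp only [key]
      exact ((Multiset.bind_congr' _ fun x => Multiset.bind_bind _ _).trans
        (Multiset.bind_bind _ _)).symm
end

mutual
theorem tsub_leaf (g : V → W) : ∀ t : PlanarTree V,
    tsub (fun v => {node (g v) []}) t = {t.map g}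
  | node v ts => by
    rw [tsub, fsub_leaf g ts, Multiset.singleton_bind, Multiset.singleton_bind, insT_leaf, map]
theorem fsub_leaf (g : V → W) : ∀ ts : List (PlanarTree V),
    fsub (fun v => {node (g v) []}) ts = {mapForest g ts}
  | [] => rfl
  | t :: ts => by
    rw [fsub, tsub_leaf g t, fsub_leaf g ts, Multiset.singleton_bind, Multiset.singleton_bind,
      mapForest]
end

mutual
theorem tsub_congr {f g : V → Multiset (PlanarTree W)} : ∀ t : PlanarTree V,
    (∀ v ∈ t.labels, f v = g v) → tsub f t = tsub g t
  | node v ts, h => by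
    rw [tsub, tsub, h v (by simp [labels]), fsub_congr ts fun v hv => h v (by simp [labels, hv])]
theorem fsub_congr {f g : V → Multiset (PlanarTree W)} : ∀ ts : List (PlanarTree V),
    (∀ v ∈ labelsForest ts, f v = g v) → fsub f ts = fsub g ts
  | [], _ => rfl
  | t :: ts, h => by
    rw [fsub, fsub, tsub_congr t fun v hv => h v (by simp [labelsForest, hv]),
      fsub_congr ts fun v hv => h v (by simp [labelsForest, hv])]
end

mutual
/-- Substitution is linear in the value at a label that occurs exactly once. -/
theorem tsub_linear {β : Type} {F : β → V → Multiset (PlanarTree W)}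
    {f : V → Multiset (PlanarTree W)} {M : Multiset β} {j : V}
    (hj : f j = M.bind fun x => F x j) (hne : ∀ x, ∀ v ≠ j, F x v = f v) :
    ∀ t : PlanarTree V, t.labels.Nodup → j ∈ t.labels → (M.bind fun x => tsub (F x) t) = tsub f t
  | node v ts, hnd, hmem => by
    simp only [labels, List.nodup_cons] at hnd
    by_cases hv : v = j
    · subst hv
      simp only [tsub]
      rw [hj, Multiset.bind_assoc]
      refine Multiset.bind_congr' _ fun x => ?_
      rw [fsub_congr ts fun w hw => hne x w fun e => hnd.1 (e ▸ hw)]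
    · have hm : j ∈ labelsForest ts := by simpa [labels, Ne.symm hv] using hmem
      simp only [tsub]
      rw [Multiset.bind_congr' M fun x => by rw [hne x v hv], Multiset.bind_bind,
        ← fsub_linear hj hne ts hnd.2 hm]
      simp only [Multiset.bind_assoc]
theorem fsub_linear {β : Type} {F : β → V → Multiset (PlanarTree W)}
    {f : V → Multiset (PlanarTree W)} {M : Multiset β} {j : V}
    (hj : f j = M.bind fun x => F x j) (hne : ∀ x, ∀ v ≠ j, F x v = f v) :
    ∀ ts : List (PlanarTree V), (labelsForest ts).Nodup → j ∈ labelsForest ts →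
      (M.bind fun x => fsub (F x) ts) = fsub f ts
  | [], _, hmem => by simp [labelsForest] at hmem
  | t :: ts, hnd, hmem => by
    simp only [labelsForest, List.nodup_append] at hnd
    simp only [fsub]
    rcases List.mem_append.1 (show j ∈ t.labels ++ labelsForest ts from hmem) with h | h
    · rw [← tsub_linear hj hne t hnd.1 h, Multiset.bind_assoc]
      refine Multiset.bind_congr' _ fun x => ?_
      rw [fsub_congr ts fun w hw => hne x w fun e => hnd.2.2 j h w hw e.symm]
    · rw [← fsub_linear hj hne ts hnd.2.1 h]
      simp only [Multiset.bind_assoc]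
      rw [Multiset.bind_bind]
      refine Multiset.bind_congr' _ fun x => ?_
      rw [tsub_congr t fun w hw => hne x w fun e => hnd.2.2 w hw j h e]
end

mutual
theorem labels_of_mem_insT : ∀ (t : PlanarTree V) (ys : List (PlanarTree V)), ∀ u ∈ insT t ys,
    u.labels.Perm (t.labels ++ labelsForest ys)
  | node v ts, ys, u, hu => by
    simp only [insT, Multiset.mem_bind, Multiset.mem_singleton] at hu
    obtain ⟨us, hus, rfl⟩ := hu
    exact (labels_of_mem_insF ts ys us hus).cons v
theorem labels_of_mem_insF : ∀ (ts ys : List (PlanarTree V)), ∀ us ∈ insF ts ys,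
    (labelsForest us).Perm (labelsForest ts ++ labelsForest ys)
  | [], ys, us, hu => by
    rw [insF, Multiset.mem_singleton] at hu
    rw [hu, labelsForest, List.nil_append]
  | t :: ts, ys, us, hu => by
    simp only [insF, mem_cut, Multiset.mem_bind, Multiset.mem_singleton] at hu
    obtain ⟨a, _, rfl, b, c, rfl, t', ht', us', hus', rfl⟩ := hu
    have h₁ := labels_of_mem_insT t b t' ht'
    have h₂ := labels_of_mem_insF ts c us' hus'
    classical
    simp only [labelsForest_eq, List.flatMap_append, List.flatMap_cons,
      List.perm_iff_count, List.count_append] at h₁ h₂ ⊢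
    intro x
    have h₁ := h₁ x
    have h₂ := h₂ x
    omega
end

end PlanarTree

/-! ### Weakly increasing sequences and decompositions into successive intervals -/

section Decompositions

variable {α β : Type}

/-- The sequence `a, F 0, F 1, …`. -/
def consSeq (a : α) (F : ℕ → α) : ℕ → α
  | 0 => a
  | n + 1 => F n

/-- The sum of `Φ F` over the decompositions `l = F 0 ++ F 1 ++ ⋯ ++ F (N - 1)`. -/
def decompSum : ℕ → List α → ((ℕ → List α) → Multiset β) → Multiset β
  | 0, [], Φ => Φ fun _ => []
  | 0, _ :: _, _ => 0
  | N + 1, l, Φ => cut l fun a b => decompSum N b fun F => Φ (consSeq a F)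

/-- Either `y` belongs to the first interval or the first interval is empty. This is the recursion
that defines `monoSeqs`: the first value is `0`, or all values are positive. -/
theorem decompSum_cons (N : ℕ) (y : α) (l : List α) (Φ : (ℕ → List α) → Multiset β) :
    decompSum (N + 1) (y :: l) Φ =
      (decompSum (N + 1) l fun F => Φ (consSeq (y :: F 0) fun n => F (n + 1))) +
        decompSum N (y :: l) fun F => Φ (consSeq [] F) := by
  rw [decompSum, cut, add_comm]
  rfl

theorem decompSum_bind {γ : Type} (N : ℕ) (l : List α) (Φ : (ℕ → List α) → Multiset β)
    (g : β → Multiset γ) :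
    (decompSum N l Φ).bind g = decompSum N l fun F => (Φ F).bind g := by
  induction N generalizing l Φ with
  | zero => cases l <;> rfl
  | succ N ih => simp only [decompSum, cut_bind, ih]

theorem decompSum_congr (N : ℕ) (l : List α) {Φ Ψ : (ℕ → List α) → Multiset β}
    (h : ∀ F, Φ F = Ψ F) : decompSum N l Φ = decompSum N l Ψ := by
  rw [show Φ = Ψ from funext h]

/-- The concatenation of the first `M` terms of `F` and the sequence `G`. -/
def appendSeq (M : ℕ) (F G : ℕ → α) (n : ℕ) : α := if n < M then F n else G (n - M)

theorem decompSum_add (M N : ℕ) (l : List α) (Φ : (ℕ → List α) → Multiset β) :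
    decompSum (M + N) l Φ = cut l fun a b => decompSum M a fun F => decompSum N b fun G =>
      Φ (appendSeq M F G) := by
  induction M generalizing l Φ with
  | zero =>
    rw [Nat.zero_add]
    cases l with
    | nil => rfl
    | cons y l =>
      rw [cut]
      simp only [decompSum]
      rw [cut_zero, add_zero]
      rfl
  | succ M ih =>
    rw [Nat.add_right_comm]
    simp only [decompSum, ih]
    have e : ∀ (a : List α) (F G : ℕ → List α),
        consSeq a (appendSeq M F G) = appendSeq (M + 1) (consSeq a F) G := fun a F G => by
      funext n
      cases n with
      | zero => simp [consSeq, appendSeq]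
      | succ n => simp [consSeq, appendSeq]
    simp only [e]
    rw [cut_assoc]

/-- The weakly increasing sequences of length `m` of integers in `[0, N)`. -/
def monoSeqs : ℕ → ℕ → Multiset (List ℕ)
  | 0, _ => {[]}
  | _ + 1, 0 => 0
  | m + 1, N + 1 => (monoSeqs m (N + 1)).map (0 :: ·) +
      (monoSeqs (m + 1) N).map (List.map (· + 1))

theorem mem_monoSeqs {m N : ℕ} {fs : List ℕ} :
    fs ∈ monoSeqs m N ↔ fs.length = m ∧ fs.Pairwise (· ≤ ·) ∧ ∀ a ∈ fs, a < N := by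
  induction m, N using monoSeqs.induct generalizing fs with
  | case1 N =>
    rw [monoSeqs, Multiset.mem_singleton]
    constructor
    · rintro rfl
      simp
    · rintro ⟨h, -, -⟩
      exact List.length_eq_zero_iff.1 h
  | case2 m =>
    simp only [monoSeqs, Multiset.notMem_zero, false_iff]
    rintro ⟨h, -, h'⟩
    cases fs with
    | nil => simp at h
    | cons a fs => exact absurd (h' a (by simp)) (by simp)
  | case3 m N ih₁ ih₂ =>
    rw [monoSeqs, Multiset.mem_add, Multiset.mem_map, Multiset.mem_map]
    constructor
    · rintro (⟨gs, hgs, rfl⟩ | ⟨gs, hgs, rfl⟩)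
      · obtain ⟨h₁, h₂, h₃⟩ := ih₁.1 hgs
        refine ⟨by simp [h₁], List.pairwise_cons.2 ⟨fun _ _ => Nat.zero_le _, h₂⟩, ?_⟩
        simpa using h₃
      · obtain ⟨h₁, h₂, h₃⟩ := ih₂.1 hgs
        refine ⟨by simp [h₁], List.pairwise_map.2 (h₂.imp fun h => by omega), ?_⟩
        simpa using h₃
    · rintro ⟨h₁, h₂, h₃⟩
      cases fs with
      | nil => simp at h₁
      | cons a fs =>
        rw [List.pairwise_cons] at h₂
        cases a with
        | zero =>
          refine Or.inl ⟨fs, ih₁.2 ⟨by simpa using h₁, h₂.2, fun b hb => h₃ b (by simp [hb])⟩, rfl⟩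
        | succ a =>
          -- The first entry is positive and the sequence increases, so truncated subtraction of `1`
          -- loses nothing.
          have hpos : ∀ b ∈ (a + 1) :: fs, b - 1 + 1 = b := fun b hb => by
            rcases List.mem_cons.1 hb with rfl | hb
            · omega
            · have := h₂.1 b hb
              omega
          refine Or.inr ⟨((a + 1) :: fs).map (· - 1), ih₂.2 ⟨by simpa using h₁, ?_, ?_⟩, ?_⟩
          · exact List.pairwise_map.2 ((List.pairwise_cons.2 h₂).imp fun h => by omega)
          · intro b hb
            obtain ⟨c, hc, rfl⟩ := List.mem_map.1 hb
            have := h₃ c hc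
            have := hpos c hc
            omega
          · rw [List.map_map]
            exact (List.map_congr_left hpos).trans (List.map_id _)

theorem nodup_monoSeqs (m N : ℕ) : (monoSeqs m N).Nodup := by
  induction m, N using monoSeqs.induct with
  | case1 N =>
    rw [monoSeqs]
    exact Multiset.nodup_singleton _
  | case2 m =>
    rw [monoSeqs]
    exact Multiset.nodup_zero
  | case3 m N ih₁ ih₂ =>
    rw [monoSeqs, Multiset.nodup_add]
    refine ⟨ih₁.map fun a b h => by simpa using h,
      ih₂.map (List.map_injective_iff.2 fun a b h => by simpa using h), ?_⟩
    rw [Multiset.disjoint_left]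
    intro x hx hy
    obtain ⟨l, -, rfl⟩ := Multiset.mem_map.1 hx
    obtain ⟨l', -, h⟩ := Multiset.mem_map.1 hy
    cases l' <;> simp at h

-- Reading off the values of a monotone map is injective, and `monoSeqs` has no repetitions, so
-- comparing the members of the two multisets suffices.
open Classical in
theorem sum_monotone {A : Type} [AddCommMonoid A] (m N : ℕ) (Φ : List ℕ → A) :
    ∑ f : {f : Fin m → Fin N // Monotone f}, Φ (List.ofFn fun k => (f.1 k : ℕ)) =
      ((monoSeqs m N).map Φ).sum := by
  have h : (Finset.univ.val.map fun f : {f : Fin m → Fin N // Monotone f} =>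
      List.ofFn fun k => (f.1 k : ℕ)) = monoSeqs m N := by
    refine (Multiset.Nodup.ext (Finset.univ.nodup.map ?_) (nodup_monoSeqs m N)).2 fun fs => ?_
    · intro f g h
      refine Subtype.ext (funext fun k => Fin.ext ?_)
      exact congrFun (List.ofFn_injective h) k
    · rw [mem_monoSeqs, Multiset.mem_map]
      constructor
      · rintro ⟨f, -, rfl⟩
        refine ⟨List.length_ofFn, List.pairwise_ofFn.2 fun i j hij => f.2 hij.le, ?_⟩
        intro a ha
        obtain ⟨k, rfl⟩ := (List.mem_ofFn' _ _).1 ha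
        exact (f.1 k).2
      · rintro ⟨rfl, h₂, h₃⟩
        refine ⟨⟨fun k => ⟨fs.get k, h₃ _ (List.get_mem _ _)⟩, fun i j hij => ?_⟩,
          Finset.mem_univ _, List.ofFn_get fs⟩
        rcases hij.eq_or_lt with rfl | hij
        · exact le_rfl
        · exact List.pairwise_iff_get.1 h₂ i j hij
  rw [← h, Multiset.map_map]
  rfl

end Decompositions

-- Weakly increasing maps to the angles and the brace operation on trees

namespace PlanarTree

variable {V W : Type}

theorem fiber_cons_zero (y : PlanarTree V) (ys : List (PlanarTree V)) (fs : List ℕ) :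
    fiber (y :: ys) (0 :: fs) =
      consSeq (y :: fiber ys fs 0) fun n => fiber ys fs (n + 1) := by
  funext n
  cases n <;> simp [fiber, consSeq]

theorem fiber_map_succ (ys : List (PlanarTree V)) (fs : List ℕ) :
    fiber ys (fs.map (· + 1)) = consSeq [] (fiber ys fs) := by
  funext n
  rw [fiber, List.zip_map_right, List.filter_map, List.map_map]
  cases n with
  | zero => simp [consSeq]
  | succ n =>
    simp only [consSeq, fiber]
    congr 1
    refine List.filter_congr fun p _ => ?_
    simp

/-- The fibers of a weakly increasing map are successive intervals; both sides obey the recursion of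
`decompSum_cons`. -/
theorem sum_monoSeqs_fiber {β : Type} (N : ℕ) (ys : List (PlanarTree V))
    (Φ : (ℕ → List (PlanarTree V)) → Multiset β) :
    ((monoSeqs ys.length N).bind fun fs => Φ (fiber ys fs)) = decompSum N ys Φ := by
  induction N generalizing ys Φ with
  | zero =>
    cases ys with
    | nil =>
      rw [List.length_nil, monoSeqs, Multiset.singleton_bind]
      rfl
    | cons y ys =>
      rw [List.length_cons, monoSeqs]
      rfl
  | succ N ihN =>
    induction ys generalizing Φ with
    | nil =>
      have h := ihN [] fun F => Φ (consSeq [] F)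
      rw [List.length_nil, monoSeqs, Multiset.singleton_bind] at h ⊢
      rw [decompSum, cut, ← h]
      congr 1
      funext n
      cases n <;> rfl
    | cons y ys ih =>
      rw [decompSum_cons, ← ih, ← ihN, List.length_cons, monoSeqs, Multiset.add_bind,
        Multiset.bind_map, Multiset.bind_map]
      simp only [fiber_cons_zero, fiber_map_succ]

mutual
theorem graft_congr {F G : ℕ → List (PlanarTree V)} : ∀ t : PlanarTree V,
    (∀ n < t.numAngles, F n = G n) → graft F t = graft G t
  | node v ts, h => by
    rw [numAngles] at h
    rw [graft, graft, h 0 (by omega), graftForest_congr ts fun n hn => h (n + 1) (by omega)]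
theorem graftForest_congr {F G : ℕ → List (PlanarTree V)} : ∀ ts : List (PlanarTree V),
    (∀ n < numAnglesForest ts, F n = G n) → graftForest F ts = graftForest G ts
  | [], _ => rfl
  | t :: ts, h => by
    rw [numAnglesForest] at h
    rw [graftForest, graftForest, graft_congr t fun n hn => h n (by omega),
      h (numAngles t) (by omega),
      graftForest_congr ts fun n hn => h (n + numAngles t + 1) (by omega)]
end

mutual
-- Angles are numbered in the left-to-right order in which `insT` distributes the trees, so giving
-- one interval to each numbered angle repeats the recursion of `insT`.
theorem decompSum_graft : ∀ (t : PlanarTree V) (ys : List (PlanarTree V)),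
    (decompSum t.numAngles ys fun F => {graft F t}) = insT t ys
  | node v ts, ys => by
    have h := congrArg (fun m => m.bind fun us => ({node v us} : Multiset (PlanarTree V)))
      (decompSum_graftForest ts ys)
    rw [decompSum_bind] at h
    simpa only [numAngles, graft, insT, Multiset.singleton_bind] using h
theorem decompSum_graftForest : ∀ (ts ys : List (PlanarTree V)),
    (decompSum (1 + numAnglesForest ts) ys fun F =>
      {F 0 ++ graftForest (fun a => F (a + 1)) ts}) = insF ts ys
  | [], ys => by
    -- With no further angle available, only the cut whose second part is empty contributes.
    have h : ∀ (l : List (PlanarTree V)) (Φ : List (PlanarTree V) → Multiset (List (PlanarTree V))),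
        (cut l fun a b => decompSum 0 b fun _ => Φ a) = Φ l := fun l => by
      induction l with
      | nil => exact fun Φ => rfl
      | cons y l ih =>
        intro Φ
        rw [cut, ih fun a => Φ (y :: a)]
        exact zero_add _
    simp only [numAnglesForest, graftForest, List.append_nil, insF]
    exact h ys fun a => {a}
  | t :: ts, ys => by
    -- The final `1` is the angle to the left of `t`. The angle to the right of `t` serves as
    -- leftmost angle for the remaining forest `ts`, whence the inner `1 +`.
    have e : 1 + numAnglesForest (t :: ts) = t.numAngles + (1 + numAnglesForest ts) + 1 := by
      rw [numAnglesForest]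
      omega
    rw [e, decompSum, insF]
    refine cut_congr _ fun a r => ?_
    rw [decompSum_add]
    refine cut_congr _ fun b c => ?_
    rw [← decompSum_graft t b, ← decompSum_graftForest ts c, decompSum_bind]
    refine decompSum_congr _ _ fun F => ?_
    rw [Multiset.singleton_bind, decompSum_bind]
    refine decompSum_congr _ _ fun G => ?_
    rw [Multiset.singleton_bind]
    have h₁ : graft (appendSeq t.numAngles F G) t = graft F t :=
      graft_congr t fun n hn => if_pos hn
    have h₂ : ∀ n, appendSeq t.numAngles F G (n + t.numAngles + 1) = G (n + 1) := fun n => by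
      rw [appendSeq, if_neg (by omega)]
      congr 1
      omega
    have h₃ : appendSeq t.numAngles F G t.numAngles = G 0 := by
      rw [appendSeq, if_neg (by omega), Nat.sub_self]
    simp only [consSeq, graftForest, h₁, h₂, h₃]
end

theorem bind_monoSeqs_graft (t : PlanarTree V) (ys : List (PlanarTree V)) :
    ((monoSeqs ys.length t.numAngles).bind fun fs => {graft (fiber ys fs) t}) = insT t ys := by
  rw [sum_monoSeqs_fiber t.numAngles ys fun F => {graft F t}, decompSum_graft]

/-! ### Partial composition of trees as a substitution -/

open Classical in
/-- The substitution of the sum `M` of trees for the label `j`. -/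
noncomputable def single {J I : Type} (j : J) (M : Multiset (PlanarTree I)) (x : J) :
    Multiset (PlanarTree ({x : J // x ≠ j} ⊕ I)) :=
  if h : x = j then M.bind fun S => {S.map Sum.inr} else {node (Sum.inl ⟨x, h⟩) []}

theorem single_self {J I : Type} (j : J) (M : Multiset (PlanarTree I)) :
    single j M j = M.bind fun S => {S.map Sum.inr} := dif_pos rfl

theorem single_of_ne {J I : Type} {j x : J} (M : Multiset (PlanarTree I)) (h : x ≠ j) :
    single j M x = {node (Sum.inl ⟨x, h⟩) []} := dif_neg h

section

variable {J I : Type} [DecidableEq J] (j : J) (S : PlanarTree I)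

mutual
-- Away from `j` nothing is grafted. As the left side does not involve `fs`, this also shows that
-- `insertAt` is then independent of `fs`.
theorem tsub_single_of_notMem (fs : List ℕ) : ∀ T : PlanarTree J, j ∉ T.labels →
    tsub (single j {S}) T = {insertAt j S fs T}
  | node x ts, h => by
    simp only [labels, List.mem_cons, not_or] at h
    rw [tsub, single_of_ne _ (Ne.symm h.1), fsub_single_of_notMem fs ts h.2,
      Multiset.singleton_bind, Multiset.singleton_bind, insT_leaf, insertAt,
      dif_neg (Ne.symm h.1)]
theorem fsub_single_of_notMem (fs : List ℕ) : ∀ ts : List (PlanarTree J), j ∉ labelsForest ts →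
    fsub (single j {S}) ts = {insertForest j S fs ts}
  | [], _ => rfl
  | t :: ts, h => by
    simp only [labelsForest, List.mem_append, not_or] at h
    rw [fsub, tsub_single_of_notMem fs t h.1, fsub_single_of_notMem fs ts h.2,
      Multiset.singleton_bind, Multiset.singleton_bind, insertForest]
end

mutual
-- The only vertex affected is `j`, which occurs once; there the sum over weakly increasing
-- sequences is `insT` by `bind_monoSeqs_graft`. This translates the composition of APE into the
-- substitution calculus.
theorem bind_insertAt : ∀ T : PlanarTree J, T.labels.Nodup → j ∈ T.labels →
    ((monoSeqs (inDegree j T) S.numAngles).bind fun fs => {insertAt j S fs T}) =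
      tsub (single j {S}) T
  | node x ts, hnd, hmem => by
    simp only [labels, List.nodup_cons] at hnd
    by_cases hx : x = j
    · subst hx
      have h : ∀ fs, insertForest x S fs ts = insertForest x S [] ts := fun fs =>
        Multiset.singleton_inj.1 ((fsub_single_of_notMem x S fs ts hnd.1).symm.trans
          (fsub_single_of_notMem x S [] ts hnd.1))
      rw [tsub, single_self, fsub_single_of_notMem x S [] ts hnd.1]
      simp only [insertAt, dif_pos, inDegree, if_pos, Multiset.singleton_bind, h]
      rw [← bind_monoSeqs_graft, length_insertForest, numAngles_map]
    · have hm : j ∈ labelsForest ts := by simpa [labels, Ne.symm hx] using hmem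
      rw [tsub, single_of_ne _ hx, Multiset.singleton_bind, ← bind_insertForest ts hnd.2 hm,
        Multiset.bind_assoc, inDegree, if_neg hx]
      refine Multiset.bind_congr' _ fun fs => ?_
      rw [Multiset.singleton_bind, insT_leaf, insertAt, dif_neg hx]
theorem bind_insertForest : ∀ ts : List (PlanarTree J), (labelsForest ts).Nodup →
    j ∈ labelsForest ts →
    ((monoSeqs (inDegreeForest j ts) S.numAngles).bind fun fs => {insertForest j S fs ts}) =
      fsub (single j {S}) ts
  | [], _, hmem => by simp [labelsForest] at hmem
  | t :: ts, hnd, hmem => by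
    simp only [labelsForest, List.nodup_append] at hnd
    simp only [fsub, insertForest, inDegreeForest]
    rcases List.mem_append.1 (show j ∈ t.labels ++ labelsForest ts from hmem) with h | h
    · have h' : j ∉ labelsForest ts := fun h' => hnd.2.2 j h j h' rfl
      rw [← bind_insertAt t hnd.1 h, Multiset.bind_assoc, inDegreeForest_eq_zero j ts h', add_zero]
      refine Multiset.bind_congr' _ fun fs => ?_
      rw [fsub_single_of_notMem j S fs ts h', Multiset.singleton_bind, Multiset.singleton_bind]
    · have h' : j ∉ t.labels := fun h' => hnd.2.2 j h' j h rfl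
      rw [← bind_insertForest ts hnd.2.1 h, inDegree_eq_zero j t h', zero_add]
      rw [tsub_single_of_notMem j S [] t h', Multiset.singleton_bind, Multiset.bind_assoc]
      refine Multiset.bind_congr' _ fun fs => ?_
      rw [Multiset.singleton_bind, Multiset.singleton_inj.1
        ((tsub_single_of_notMem j S fs t h').symm.trans (tsub_single_of_notMem j S [] t h'))]
end

end

/-- Linearity in the substituted sum relies on `j` labelling exactly one vertex. -/
theorem bind_tsub_single {J I : Type} (j : J) (M : Multiset (PlanarTree I)) (T : PlanarTree J)
    (hnd : T.labels.Nodup) (hmem : j ∈ T.labels) :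
    (M.bind fun S => tsub (single j {S}) T) = tsub (single j M) T := by
  refine tsub_linear ?_ (fun S x hx => ?_) T hnd hmem
  · simp only [single_self, Multiset.singleton_bind]
  · rw [single_of_ne _ hx, single_of_ne _ hx]

end PlanarTree

/-! ### Homomorphisms of operads -/

namespace OperadData

/-- Homomorphisms of operads. -/
structure Hom (P Q : OperadData) where
  app : ∀ (I : Type) [Finite I], P.obj I →+ Q.obj I
  app_map : ∀ {I J : Type} [Finite I] [Finite J] (e : I ≃ J) (p : P.obj I),
    app J (P.map e p) = Q.map e (app I p)
  app_one : app Unit P.one = Q.one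
  app_comp : ∀ {J I : Type} [Finite J] [Finite I] (j : J) (p : P.obj J) (q : P.obj I),
    app _ (P.comp j p q) = Q.comp j (app J p) (app I q)

/-- Every axiom is an equation between expressions preserved by homomorphisms, so it can be checked
on preimages. No axiom is assumed for `Q`, which allows the use for both APE and the quotient. -/
theorem IsOperad.of_surjective {P Q : OperadData} (hP : P.IsOperad) (φ : Hom P Q)
    (hφ : ∀ (I : Type) [Finite I], Function.Surjective (φ.app I)) : Q.IsOperad where
  map_refl I _ p := by
    obtain ⟨p, rfl⟩ := hφ I p
    rw [← φ.app_map, hP.map_refl]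
  map_trans {I J K} _ _ _ e f p := by
    obtain ⟨p, rfl⟩ := hφ I p
    rw [← φ.app_map, ← φ.app_map, ← φ.app_map, hP.map_trans]
  comp_equivariant {J J' I I'} _ _ _ _ σ τ j p q := by
    obtain ⟨p, rfl⟩ := hφ J p
    obtain ⟨q, rfl⟩ := hφ I q
    rw [← φ.app_map, ← φ.app_map, ← φ.app_comp, ← φ.app_comp, ← φ.app_map, hP.comp_equivariant]
  one_comp {I} _ q := by
    obtain ⟨q, rfl⟩ := hφ I q
    rw [← φ.app_one, ← φ.app_comp, ← φ.app_map, hP.one_comp]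
  comp_one {J} _ j p := by
    obtain ⟨p, rfl⟩ := hφ J p
    rw [← φ.app_one, ← φ.app_comp, ← φ.app_map, hP.comp_one]
  comp_seq {J I K} _ _ _ j i p q r := by
    obtain ⟨p, rfl⟩ := hφ J p
    obtain ⟨q, rfl⟩ := hφ I q
    obtain ⟨r, rfl⟩ := hφ K r
    rw [← φ.app_comp, ← φ.app_comp, ← φ.app_comp, ← φ.app_comp, ← φ.app_map, hP.comp_seq]
  comp_par {J I K} _ _ _ j j' h p q r := by
    obtain ⟨p, rfl⟩ := hφ J p
    obtain ⟨q, rfl⟩ := hφ I q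
    obtain ⟨r, rfl⟩ := hφ K r
    rw [← φ.app_comp, ← φ.app_comp, ← φ.app_comp, ← φ.app_comp, ← φ.app_map, hP.comp_par]

/-- The projection to a quotient, as a homomorphism of operads. -/
def quotientHom (P : OperadData) (N : P.Ideal) : Hom P (P.quotient N) where
  app I _ := P.toQuotient N I
  app_map _ _ := rfl
  app_one := rfl
  app_comp _ _ _ := rfl

theorem toQuotient_surjective (P : OperadData) (N : P.Ideal) (I : Type) [Finite I] :
    Function.Surjective (P.toQuotient N I) := QuotientAddGroup.mk'_surjective _

theorem toQuotient_eq_zero (P : OperadData) (N : P.Ideal) {I : Type} [Finite I] {p : P.obj I} :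
    P.toQuotient N I p = 0 ↔ p ∈ N.carrier I := QuotientAddGroup.eq_zero_iff p

theorem IsOperad.quotient {P : OperadData} (hP : P.IsOperad) (N : P.Ideal) :
    (P.quotient N).IsOperad :=
  hP.of_surjective (P.quotientHom N) fun I _ => P.toQuotient_surjective N I

/-- A homomorphism that kills a family of sets kills the ideal that it generates. -/
theorem Hom.app_eq_zero_of_spanMem {P Q : OperadData} (φ : Hom P Q)
    {R : ∀ (I : Type) [Finite I], Set (P.obj I)}
    (hR : ∀ (I : Type) [Finite I], ∀ p ∈ R I, φ.app I p = 0) {I : Type} [Finite I] {p : P.obj I}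
    (hp : SpanMem P R I p) : φ.app I p = 0 := by
  induction hp with
  | of p h => exact hR _ p h
  | zero I => exact map_zero _
  | add p q _ _ h₁ h₂ => rw [map_add, h₁, h₂, add_zero]
  | neg p _ h => rw [map_neg, h, neg_zero]
  | map e p _ h => rw [φ.app_map, h, map_zero]
  | comp_left j p q _ h => rw [φ.app_comp, h, map_zero, AddMonoidHom.zero_apply]
  | comp_right j p q _ h => rw [φ.app_comp, h, map_zero]

end OperadData

/-! ### The free operad is an operad -/

namespace OpTerm

variable {G : Type} {ar : G → ℕ}

theorem subst_subst {U V W : Type} (f : U → OpTerm ar V) (g : V → OpTerm ar W)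
    (t : OpTerm ar U) : (t.subst f).subst g = t.subst fun u => (f u).subst g := by
  induction t with
  | var v => rfl
  | op a ts ih => simp only [subst, ih]

theorem subst_var {V : Type} (t : OpTerm ar V) : t.subst var = t := by
  induction t with
  | var v => rfl
  | op a ts ih => simp only [subst, ih]

theorem subst_eq_self {V : Type} {f : V → OpTerm ar V} (h : ∀ v, f v = var v) (t : OpTerm ar V) :
    t.subst f = t := by
  rw [show f = var from funext h, subst_var]

end OpTerm

namespace FreeOperad

variable {G : Type} {ar : G → ℕ}

/-- A multilinear term as an element of the free operad. -/
noncomputable def of {I : Type} [Finite I] (t : OpTerm ar I) (ht : Exhausts t.vars) :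
    (FreeOperad ar).obj I :=
  FreeAbelianGroup.of (⟨t, ht⟩ : MultilinearTerm ar I)

theorem exhausts_insertAt {J I : Type} (j : J) {t : OpTerm ar J} {s : OpTerm ar I}
    (ht : Exhausts t.vars) (hs : Exhausts s.vars) : Exhausts (t.insertAt j s).vars := by
  classical
  rw [OpTerm.vars_insertAt]
  exact ht.replaceAt hs j

theorem exhausts_rename {I J : Type} (e : I ≃ J) {t : OpTerm ar I} (ht : Exhausts t.vars) :
    Exhausts (t.rename e).vars := by
  rw [OpTerm.vars_rename]
  exact ht.map e

@[elab_as_elim]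
theorem induction {I : Type} [Finite I] {C : (FreeOperad ar).obj I → Prop}
    (hof : ∀ t ht, C (of t ht)) (hneg : ∀ p, C p → C (-p)) (hadd : ∀ p q, C p → C q → C (p + q))
    (hzero : C 0) (p : (FreeOperad ar).obj I) : C p :=
  FreeAbelianGroup.induction_on (motive := C) p hzero (fun t => hof t.1 t.2)
    (fun t h => hneg (of t.1 t.2) h) (fun x y hx hy => hadd x y hx hy)

theorem comp_of {J I : Type} [Finite J] [Finite I] (j : J) (t : OpTerm ar J) (ht : Exhausts t.vars)
    (s : OpTerm ar I) (hs : Exhausts s.vars) : (FreeOperad ar).comp j (of t ht) (of s hs) =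
      of (t.insertAt j s) (exhausts_insertAt j ht hs) :=
  (DFunLike.congr_fun (FreeAbelianGroup.lift_apply_of _ _) (of s hs)).trans
    (FreeAbelianGroup.lift_apply_of _ _)

theorem map_of {I J : Type} [Finite I] [Finite J] (e : I ≃ J) (t : OpTerm ar I)
    (ht : Exhausts t.vars) :
    (FreeOperad ar).map e (of t ht) = of (t.rename e) (exhausts_rename e ht) :=
  FreeAbelianGroup.map_of_apply _

theorem of_congr {I : Type} [Finite I] {t s : OpTerm ar I} {ht : Exhausts t.vars}
    {hs : Exhausts s.vars} (h : t = s) : of t ht = of s hs := by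
  subst h
  rfl

theorem exhausts_var : Exhausts (OpTerm.var () : OpTerm ar Unit).vars := by
  simp [Exhausts, OpTerm.vars]

/-- By additivity it suffices to treat terms. Each axiom then compares two iterated substitutions,
which agree because they agree on each variable. -/
theorem isOperad : (FreeOperad ar).IsOperad where
  map_refl I _ p := by
    refine induction (fun t ht => ?_) (fun p h => ?_) (fun p q h₁ h₂ => ?_) ?_ p
    · rw [map_of]
      exact of_congr (OpTerm.subst_var _)
    · rw [map_neg, h]
    · rw [map_add, h₁, h₂]
    · exact map_zero _
  map_trans e f p := by
    refine induction (fun t ht => ?_) (fun p h => ?_) (fun p q h₁ h₂ => ?_) ?_ p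
    · rw [map_of, map_of, map_of]
      refine of_congr ?_
      simp only [OpTerm.rename, OpTerm.subst_subst]
      rfl
    · simp only [map_neg, h]
    · simp only [map_add, h₁, h₂]
    · simp only [map_zero]
  comp_equivariant σ τ j p q := by
    refine induction (fun t ht => ?_) (fun p h => ?_) (fun p q h₁ h₂ => ?_) ?_ p
    · refine induction (fun s hs => ?_) (fun p h => ?_) (fun p q h₁ h₂ => ?_) ?_ q
      · rw [map_of, map_of, comp_of, comp_of, map_of]
        refine of_congr ?_
        simp only [OpTerm.insertAt, OpTerm.rename, OpTerm.subst_subst]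
        congr 1
        funext x
        by_cases hx : x = j
        · subst hx
          simp [OpTerm.subst, OpTerm.subst_subst, OperadData.congrEquiv]
        · simp [OpTerm.subst, hx, OperadData.congrEquiv]
      · simp only [map_neg, h]
      · simp only [map_add, h₁, h₂]
      · simp only [map_zero]
    · simp only [map_neg, h, AddMonoidHom.neg_apply]
    · simp only [map_add, h₁, h₂, AddMonoidHom.add_apply]
    · simp only [map_zero, AddMonoidHom.zero_apply]
  one_comp q := by
    refine induction (fun t ht => ?_) (fun p h => ?_) (fun p q h₁ h₂ => ?_) ?_ q
    · rw [show (FreeOperad ar).one = of (OpTerm.var ()) exhausts_var from rfl,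
        comp_of, map_of]
      refine of_congr ?_
      simp only [OpTerm.insertAt, OpTerm.rename, OpTerm.subst, dif_pos, OpTerm.subst_subst]
      exact OpTerm.subst_var _
    · simp only [map_neg, h]
    · simp only [map_add, h₁, h₂]
    · simp only [map_zero]
  comp_one j p := by
    refine induction (fun t ht => ?_) (fun p h => ?_) (fun p q h₁ h₂ => ?_) ?_ p
    · rw [show (FreeOperad ar).one = of (OpTerm.var ()) exhausts_var from rfl,
        comp_of, map_of]
      refine of_congr ?_
      simp only [OpTerm.insertAt, OpTerm.rename, OpTerm.subst_subst]
      refine OpTerm.subst_eq_self (fun x => ?_) _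
      by_cases hx : x = j
      · subst hx
        simp [OpTerm.subst, OperadData.rightUnitEquiv]
      · simp [OpTerm.subst, hx, OperadData.rightUnitEquiv]
    · simp only [map_neg, h, AddMonoidHom.neg_apply]
    · simp only [map_add, h₁, h₂, AddMonoidHom.add_apply]
    · simp only [map_zero, AddMonoidHom.zero_apply]
  comp_seq {J I K} _ _ _ j i p q r := by
    refine induction (fun t ht => ?_) (fun p h => ?_) (fun p q h₁ h₂ => ?_) ?_ p
    · refine induction (fun s hs => ?_) (fun p h => ?_) (fun p q h₁ h₂ => ?_) ?_ q
      · refine induction (fun u hu => ?_) (fun p h => ?_) (fun p q h₁ h₂ => ?_) ?_ r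
        · rw [comp_of, comp_of, comp_of, comp_of, map_of]
          refine of_congr ?_
          simp only [OpTerm.insertAt, OpTerm.rename, OpTerm.subst_subst]
          congr 1
          funext x
          by_cases hx : x = j
          · subst hx
            simp only [dif_pos, OpTerm.subst_subst, OpTerm.subst]
            congr 1
            funext y
            by_cases hy : y = i
            · subst hy
              simp [OpTerm.subst, OpTerm.subst_subst, OperadData.seqEquiv]
            · simp [OpTerm.subst, hy, OperadData.seqEquiv]
          · simp [OpTerm.subst, hx, OperadData.seqEquiv]
        · simp only [map_neg, h]
        · simp only [map_add, h₁, h₂]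
        · simp only [map_zero]
      · simp only [map_neg, h, AddMonoidHom.neg_apply]
      · simp only [map_add, h₁, h₂, AddMonoidHom.add_apply]
      · simp only [map_zero, AddMonoidHom.zero_apply]
    · simp only [map_neg, h, AddMonoidHom.neg_apply]
    · simp only [map_add, h₁, h₂, AddMonoidHom.add_apply]
    · simp only [map_zero, AddMonoidHom.zero_apply]
  comp_par {J I K} _ _ _ j j' hj p q r := by
    refine induction (fun t ht => ?_) (fun p h => ?_) (fun p q h₁ h₂ => ?_) ?_ p
    · refine induction (fun s hs => ?_) (fun p h => ?_) (fun p q h₁ h₂ => ?_) ?_ q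
      · refine induction (fun u hu => ?_) (fun p h => ?_) (fun p q h₁ h₂ => ?_) ?_ r
        · rw [comp_of, comp_of, comp_of, comp_of, map_of]
          refine of_congr ?_
          simp only [OpTerm.insertAt, OpTerm.rename, OpTerm.subst_subst]
          congr 1
          funext x
          by_cases hx : x = j
          · subst hx
            simp [OpTerm.subst_subst, OpTerm.subst, hj.symm, OperadData.parEquiv]
          · by_cases hx' : x = j'
            · subst hx'
              simp [OpTerm.subst_subst, OpTerm.subst, hj, OperadData.parEquiv]
            · simp [OpTerm.subst, hx, hx', OperadData.parEquiv]
        · simp only [map_neg, h, AddMonoidHom.neg_apply]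
        · simp only [map_add, h₁, h₂, AddMonoidHom.add_apply]
        · simp only [map_zero, AddMonoidHom.zero_apply]
      · simp only [map_neg, h, AddMonoidHom.neg_apply]
      · simp only [map_add, h₁, h₂, AddMonoidHom.add_apply]
      · simp only [map_zero, AddMonoidHom.zero_apply]
    · simp only [map_neg, h, AddMonoidHom.neg_apply]
    · simp only [map_add, h₁, h₂, AddMonoidHom.add_apply]
    · simp only [map_zero, AddMonoidHom.zero_apply]

end FreeOperad

/-! ### Evaluation of brace terms as sums of trees -/

/-- The lists whose entries are taken from the successive members of a list of multisets. -/
def listProd {α : Type} : List (Multiset α) → Multiset (List α)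
  | [] => {[]}
  | m :: l => m.bind fun s => (listProd l).bind fun us => {s :: us}

namespace OpTerm

open PlanarTree

variable {V W : Type}

/-- The value of a brace term in the sums of planar trees. -/
def eval : OpTerm braceArity V → Multiset (PlanarTree V)
  | var v => {node v []}
  | op g ts => (eval (ts ⟨0, Nat.succ_pos _⟩)).bind fun a =>
      (listProd (List.ofFn fun i : Fin g => eval (ts i.succ))).bind fun us => insT a us

theorem listProd_bind_fsub (f : V → Multiset (PlanarTree W))
    (l : List (Multiset (PlanarTree V))) :
    ((listProd l).bind fun us => fsub f us) = listProd (l.map fun m => m.bind (tsub f)) := by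
  induction l with
  | nil => simp only [listProd, List.map_nil, Multiset.singleton_bind, fsub]
  | cons m l ih =>
    simp only [listProd, List.map_cons, Multiset.bind_assoc, Multiset.singleton_bind, fsub, ← ih]
    refine Multiset.bind_congr' _ fun s => ?_
    rw [Multiset.bind_bind]

/-- Evaluation of a composite uses that `tsub` commutes with the brace operation (`insT_tsub`),
applied at each generator. -/
theorem eval_subst (f : V → OpTerm braceArity W) (t : OpTerm braceArity V) :
    (t.subst f).eval = t.eval.bind (tsub fun v => (f v).eval) := by
  induction t with
  | var v =>
    simp only [subst, eval, Multiset.singleton_bind, tsub, fsub, insT_nil]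
    rw [Multiset.bind_singleton, Multiset.map_id']
  | op g ts ih =>
    simp only [subst, eval, ih, Multiset.bind_assoc, insT_tsub]
    refine Multiset.bind_congr' _ fun a => Eq.trans ?_ (Multiset.bind_bind _ _)
    refine Multiset.bind_congr' _ fun a' => ?_
    rw [← Multiset.bind_assoc, listProd_bind_fsub, List.map_ofFn,
      show (fun i : Fin g => ((ts i.succ).subst f).eval) =
        (fun m => m.bind (tsub fun v => (f v).eval)) ∘ fun i : Fin g => (ts i.succ).eval from
        funext fun i => ih i.succ]

theorem eval_rename (g : V → W) (t : OpTerm braceArity V) :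
    (t.rename g).eval = t.eval.bind fun T => {T.map g} := by
  rw [rename, eval_subst]
  simp only [eval, tsub_leaf]

theorem labels_of_mem_listProd {n : ℕ} {m : Fin n → OpTerm braceArity V}
    (h : ∀ i, ∀ u ∈ (m i).eval, u.labels.Perm (m i).vars) {us : List (PlanarTree V)}
    (hus : us ∈ listProd (List.ofFn fun i => (m i).eval)) :
    (labelsForest us).Perm (List.ofFn fun i => (m i).vars).flatten := by
  induction n generalizing us with
  | zero =>
    rw [List.ofFn_zero, listProd, Multiset.mem_singleton] at hus
    rw [hus, List.ofFn_zero]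
    rfl
  | succ n ih =>
    simp only [List.ofFn_succ, listProd, Multiset.mem_bind, Multiset.mem_singleton] at hus
    obtain ⟨s, hs, us, hus, rfl⟩ := hus
    rw [List.ofFn_succ, List.flatten_cons, labelsForest]
    exact (h 0 s hs).append (ih (fun i => h i.succ) hus)

theorem labels_of_mem_eval {t : OpTerm braceArity V} {u : PlanarTree V} (hu : u ∈ t.eval) :
    u.labels.Perm t.vars := by
  induction t generalizing u with
  | var v =>
    rw [eval, Multiset.mem_singleton] at hu
    subst hu
    rfl
  | op g ts ih =>
    simp only [eval, Multiset.mem_bind] at hu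
    obtain ⟨a, ha, us, hus, hu⟩ := hu
    refine (labels_of_mem_insT a us u hu).trans ?_
    refine ((ih _ ha).append (labels_of_mem_listProd (fun i _ h => ih _ h) hus)).trans ?_
    refine List.Perm.of_eq ?_
    rw [vars]
    exact (congrArg List.flatten (List.ofFn_succ (n := g) (f := fun i => (ts i).vars))).symm

theorem eval_exhausts {t : OpTerm braceArity V} (ht : Exhausts t.vars) :
    ∀ u ∈ t.eval, Exhausts u.labels := fun _ hu => ht.perm (labels_of_mem_eval hu)

theorem eval_brace (t₀ : OpTerm braceArity V) (l : List (OpTerm braceArity V)) :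
    (brace t₀ l).eval =
      t₀.eval.bind fun a => (listProd (l.map eval)).bind fun us => insT a us := by
  cases l with
  | nil =>
    simp only [brace, List.map_nil, listProd, Multiset.singleton_bind, insT_nil]
    rw [Multiset.bind_singleton, Multiset.map_id']
  | cons t ts =>
    have h : (List.ofFn fun i : Fin (t :: ts).length => ((t₀ :: t :: ts).get i.succ).eval) =
        (t :: ts).map eval := by
      conv_rhs => rw [← List.ofFn_get (t :: ts), List.map_ofFn]
      rfl
    rw [← h]
    rfl

end OpTerm

-- Sums of trees as elements of APE, and the evaluation homomorphism

namespace APE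

open PlanarTree

/-- A planar tree as an element of APE. -/
noncomputable def of {I : Type} [Finite I] (T : PlanarTree I) (hT : Exhausts T.labels) :
    APE.obj I :=
  FreeAbelianGroup.of (⟨T, hT⟩ : PlanarTreeOn I)

@[elab_as_elim]
theorem induction {I : Type} [Finite I] {C : APE.obj I → Prop}
    (hof : ∀ t ht, C (of t ht)) (hneg : ∀ p, C p → C (-p)) (hadd : ∀ p q, C p → C q → C (p + q))
    (hzero : C 0) (p : APE.obj I) : C p :=
  FreeAbelianGroup.induction_on (motive := C) p hzero (fun t => hof t.1 t.2)
    (fun t h => hneg (of t.1 t.2) h) (fun x y hx hy => hadd x y hx hy)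

open Classical in
/-- The element of APE given by a tree, and `0` if the labels do not occur exactly once. -/
noncomputable def proj {I : Type} [Finite I] (T : PlanarTree I) : APE.obj I :=
  if h : Exhausts T.labels then of T h else 0

theorem proj_eq {I : Type} [Finite I] {T : PlanarTree I} (h : Exhausts T.labels) :
    proj T = of T h := dif_pos h

/-- The element of APE given by a sum of trees. -/
noncomputable def sumOf {I : Type} [Finite I] (M : Multiset (PlanarTree I)) : APE.obj I :=
  (M.map proj).sum

section

variable {I J : Type} [Finite I] [Finite J]

theorem sumOf_zero : sumOf (0 : Multiset (PlanarTree I)) = 0 := rfl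

theorem sumOf_add (M N : Multiset (PlanarTree I)) : sumOf (M + N) = sumOf M + sumOf N := by
  rw [sumOf, Multiset.map_add, Multiset.sum_add]
  rfl

theorem sumOf_singleton (T : PlanarTree I) : sumOf {T} = proj T := by
  rw [sumOf, Multiset.map_singleton, Multiset.sum_singleton]

theorem sumOf_bind {β : Type} (M : Multiset β) (f : β → Multiset (PlanarTree I)) :
    sumOf (M.bind f) = (M.map fun x => sumOf (f x)).sum := by
  rw [sumOf, Multiset.map_bind, Multiset.sum_bind]
  rfl

theorem map_of (e : I ≃ J) (T : PlanarTree I) (hT : Exhausts T.labels) :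
    APE.map e (of T hT) = of (T.map e) (by rw [labels_map]; exact hT.map e) :=
  FreeAbelianGroup.map_of_apply _

open Classical in
theorem comp_of (j : J) (T : PlanarTree J) (hT : Exhausts T.labels) (S : PlanarTree I)
    (hS : Exhausts S.labels) :
    APE.comp j (of T hT) (of S hS) = sumOf (tsub (single j {S}) T) := by
  have h : APE.comp j (of T hT) (of S hS) = ∑ f : PlanarTreeOn.GraftingMap j ⟨T, hT⟩ ⟨S, hS⟩,
      (proj (insertAt j S (List.ofFn fun k => (f.1 k : ℕ)) T) : APE.obj _) := by
    refine ((DFunLike.congr_fun (FreeAbelianGroup.lift_apply_of _ _) (of S hS)).trans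
      (FreeAbelianGroup.lift_apply_of _ _)).trans ?_
    refine Finset.sum_congr rfl fun f _ => ?_
    exact (proj_eq (PlanarTreeOn.compMap j ⟨T, hT⟩ ⟨S, hS⟩ f).2).symm
  rw [h, ← bind_insertAt j S T hT.1 (hT.2 j), sumOf_bind,
    sum_monotone (inDegree j T) S.numAngles fun fs => proj (insertAt j S fs T)]
  simp only [sumOf_singleton]

/-- Additivity in `M` is that of `bind`; additivity in `N` is `bind_tsub_single`. The hypotheses
keep the default value of `proj` from appearing. -/
theorem comp_sumOf (j : J) {M : Multiset (PlanarTree J)} {N : Multiset (PlanarTree I)}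
    (hM : ∀ T ∈ M, Exhausts T.labels) (hN : ∀ S ∈ N, Exhausts S.labels) :
    APE.comp j (sumOf M) (sumOf N) = sumOf (M.bind (tsub (single j N))) := by
  induction M using Multiset.induction_on with
  | empty =>
    rw [sumOf_zero, map_zero, Multiset.zero_bind]
    rfl
  | cons T M ih =>
    have hT := hM T (Multiset.mem_cons_self T M)
    rw [Multiset.cons_bind, ← Multiset.singleton_add, sumOf_add, sumOf_add, map_add,
      AddMonoidHom.add_apply, ih fun T hT => hM T (Multiset.mem_cons_of_mem hT), sumOf_singleton,
      proj_eq hT, ← bind_tsub_single j N T hT.1 (hT.2 j)]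
    congr 1
    clear ih hM
    induction N using Multiset.induction_on with
    | empty =>
      rw [sumOf_zero, map_zero, Multiset.zero_bind]
      rfl
    | cons S N ih =>
      rw [Multiset.cons_bind, ← Multiset.singleton_add, sumOf_add, sumOf_add, map_add,
        ih fun S hS => hN S (Multiset.mem_cons_of_mem hS), sumOf_singleton,
        proj_eq (hN S (Multiset.mem_cons_self S N)), comp_of]

theorem map_sumOf (e : I ≃ J) {M : Multiset (PlanarTree I)} (hM : ∀ T ∈ M, Exhausts T.labels) :
    APE.map e (sumOf M) = sumOf (M.bind fun T => {T.map e}) := by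
  induction M using Multiset.induction_on with
  | empty => exact map_zero _
  | cons T M ih =>
    have hT := hM T (Multiset.mem_cons_self T M)
    rw [Multiset.cons_bind, ← Multiset.singleton_add, sumOf_add, sumOf_add, map_add,
      ih fun T hT => hM T (Multiset.mem_cons_of_mem hT), sumOf_singleton, sumOf_singleton,
      proj_eq hT, map_of, proj_eq]

end

theorem eval_insertAt {J I : Type} (j : J) (t : OpTerm braceArity J) (s : OpTerm braceArity I) :
    (t.insertAt j s).eval = t.eval.bind (tsub (single j s.eval)) := by
  rw [OpTerm.insertAt, OpTerm.eval_subst]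
  congr 1
  funext T
  congr 1
  funext x
  by_cases hx : x = j
  · rw [dif_pos hx, OpTerm.eval_rename, single, dif_pos hx]
  · rw [dif_neg hx, single, dif_neg hx]
    rfl

/-- The evaluation of the elements of the free operad. -/
noncomputable def evalApp (I : Type) [Finite I] : (FreeOperad braceArity).obj I →+ APE.obj I :=
  FreeAbelianGroup.lift fun t : MultilinearTerm braceArity I => sumOf t.1.eval

theorem evalApp_of {I : Type} [Finite I] (t : OpTerm braceArity I) (ht : Exhausts t.vars) :
    evalApp I (FreeOperad.of t ht) = sumOf t.eval := FreeAbelianGroup.lift_apply_of _ _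

/-- The evaluation, as a homomorphism of operads. -/
noncomputable def evalHom : OperadData.Hom (FreeOperad braceArity) APE where
  app I _ := evalApp I
  app_map e p := by
    refine FreeOperad.induction (fun t ht => ?_) (fun p h => ?_) (fun p q h₁ h₂ => ?_) ?_ p
    · rw [FreeOperad.map_of, evalApp_of, evalApp_of, map_sumOf e (OpTerm.eval_exhausts ht),
        OpTerm.eval_rename]
    · simp only [map_neg, h]
    · simp only [map_add, h₁, h₂]
    · simp only [map_zero]
  app_one := (evalApp_of (OpTerm.var ()) FreeOperad.exhausts_var).trans
    ((sumOf_singleton _).trans (proj_eq PlanarTreeOn.one.2))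
  app_comp j p q := by
    refine FreeOperad.induction (fun t ht => ?_) (fun p h => ?_) (fun p q h₁ h₂ => ?_) ?_ p
    · refine FreeOperad.induction (fun s hs => ?_) (fun p h => ?_) (fun p q h₁ h₂ => ?_) ?_ q
      · rw [FreeOperad.comp_of, evalApp_of, evalApp_of, evalApp_of,
          comp_sumOf j (OpTerm.eval_exhausts ht) (OpTerm.eval_exhausts hs), eval_insertAt]
      · simp only [map_neg, h]
      · simp only [map_add, h₁, h₂]
      · simp only [map_zero]
    · simp only [map_neg, h, AddMonoidHom.neg_apply]
    · simp only [map_add, h₁, h₂, AddMonoidHom.add_apply]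
    · simp only [map_zero, AddMonoidHom.zero_apply]

end APE

/-! ### The brace relations hold for planar trees -/

namespace OpTerm

open PlanarTree

variable {V : Type}

theorem listProd_append {α : Type} (l l' : List (Multiset α)) :
    listProd (l ++ l') = (listProd l).bind fun a => (listProd l').bind fun b => {a ++ b} := by
  induction l with
  | nil =>
    simp only [List.nil_append, listProd, Multiset.singleton_bind]
    rw [Multiset.bind_singleton, Multiset.map_id']
  | cons m l ih =>
    simp only [List.cons_append, listProd, ih, Multiset.bind_assoc, Multiset.singleton_bind]

theorem listProd_flatMap_eval {ι : Type} (l : List ι) {A : ι → List (OpTerm braceArity V)}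
    {B : ι → List (PlanarTree V)} (h : ∀ i, listProd ((A i).map eval) = {B i}) :
    listProd ((l.flatMap A).map eval) = {l.flatMap B} := by
  induction l with
  | nil => rfl
  | cons i l ih =>
    rw [List.flatMap_cons, List.map_append, listProd_append, h, ih, Multiset.singleton_bind,
      Multiset.singleton_bind, List.flatMap_cons]

theorem listProd_map_var {ι : Type} (l : List ι) (g : ι → V) :
    listProd ((l.map fun i => (var (g i) : OpTerm braceArity V)).map eval) =
      {l.map fun i => node (g i) []} := by
  induction l with
  | nil => rfl
  | cons i l ih =>
    rw [List.map_cons, List.map_cons, listProd, ih, eval, Multiset.singleton_bind,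
      Multiset.singleton_bind, List.map_cons]

end OpTerm

namespace PlanarTree

/-- With the leftmost root angle left out of the count, leaf `i` has the single angle `2i`, and the
root angle following it is `2i + 1`. -/
theorem graftForest_leaves {V : Type} {n : ℕ} (x : Fin n → V) (F : ℕ → List (PlanarTree V)) :
    graftForest F ((List.finRange n).map fun i => node (x i) []) =
      (List.finRange n).flatMap fun i => node (x i) (F (2 * i)) :: F (2 * i + 1) := by
  induction n generalizing F with
  | zero => rfl
  | succ n ih =>
    simp only [List.finRange_succ, List.map_cons, List.map_map, List.flatMap_cons,
      List.flatMap_map, graftForest, graft, numAngles, numAnglesForest, List.append_nil,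
      Function.comp_def, ih]
    simp [Nat.mul_add, Nat.add_right_comm]

theorem numAnglesForest_leaves {V ι : Type} (l : List ι) (x : ι → V) :
    numAnglesForest (l.map fun i => node (x i) []) = 2 * l.length := by
  induction l with
  | nil => rfl
  | cons i l ih =>
    rw [List.map_cons, numAnglesForest, ih, numAngles, numAnglesForest, List.length_cons]
    omega

end PlanarTree

namespace BraceRelation

open PlanarTree OpTerm

variable {n m : ℕ}

/-- The tree `{z ∣ x_1, …, x_n}`. -/
def corolla (n m : ℕ) : PlanarTree (BraceVar n m) :=
  node (Sum.inl ()) ((List.finRange n).map fun i => node (Sum.inr (Sum.inl i)) [])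

/-- The forest `y_1, …, y_m`. -/
def leaves (n m : ℕ) : List (PlanarTree (BraceVar n m)) :=
  (List.finRange m).map fun i => node (Sum.inr (Sum.inr i)) []

theorem eval_lhs : (lhs n m).eval = insT (corolla n m) (leaves n m) := by
  have hx : listProd (((List.finRange n).map (x : Fin n → OpTerm braceArity (BraceVar n m))).map
      eval) = {(List.finRange n).map fun i => node (Sum.inr (Sum.inl i)) []} :=
    listProd_map_var _ _
  have hy : listProd (((List.finRange m).map (y : Fin m → OpTerm braceArity (BraceVar n m))).map
      eval) = {leaves n m} := listProd_map_var _ _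
  rw [lhs, eval_brace, eval_brace, hx, hy, z, eval]
  simp only [Multiset.singleton_bind, insT_leaf]
  rfl

theorem fiber_leaves (c : Decomposition n m) (k : ℕ) :
    fiber (leaves n m) (List.ofFn fun i => (c.1 i : ℕ)) k =
      ((List.finRange m).filter fun i => (c.1 i : ℕ) = k).map
        fun i => node (Sum.inr (Sum.inr i)) [] := by
  rw [fiber, leaves, List.ofFn_eq_map, List.zip_map', List.filter_map, List.map_map]
  rfl

theorem listProd_Y (c : Decomposition n m) (k : ℕ) : listProd ((Y c k).map eval) =
    {fiber (leaves n m) (List.ofFn fun i => (c.1 i : ℕ)) k} := by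
  rw [fiber_leaves]
  exact listProd_map_var _ _

/-- Only one-vertex trees receive grafts, so no choice remains and the value is a single tree: odd
angles of the corolla belong to the leaves `x_i`, even ones to the root `z`. -/
theorem eval_rhs (c : Decomposition n m) : (rhs c).eval =
    {graft (fiber (leaves n m) (List.ofFn fun i => (c.1 i : ℕ))) (corolla n m)} := by
  have h := listProd_flatMap_eval (List.finRange n)
    (A := fun i => brace (x i) (Y c (2 * i + 1)) :: Y c (2 * i + 2))
    (B := fun i => node (Sum.inr (Sum.inl i))
      (fiber (leaves n m) (List.ofFn fun i => (c.1 i : ℕ)) (2 * i + 1)) ::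
        fiber (leaves n m) (List.ofFn fun i => (c.1 i : ℕ)) (2 * i + 2)) fun i => by
      rw [List.map_cons, listProd, eval_brace, listProd_Y, listProd_Y, x, eval]
      simp only [Multiset.singleton_bind, insT_leaf]
  rw [rhs, eval_brace, List.map_append, listProd_append, listProd_Y, h, z, eval, corolla, graft,
    graftForest_leaves]
  simp only [Multiset.singleton_bind, insT_leaf]

/-- The left side grafts the `y`'s into the corolla in all ordered ways, which are indexed by the
weakly increasing maps from `m` leaves to `2n + 1` angles, that is, by the decompositions. -/
theorem evalApp_relator : APE.evalApp (BraceVar n m) (relator n m) = 0 := by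
  classical
  have h : APE.evalApp (BraceVar n m) (relator n m) =
      APE.evalApp _ (FreeOperad.of (lhs n m) (exhausts_lhs n m)) -
        ∑ c : Decomposition n m, APE.evalApp _ (FreeOperad.of (rhs c) (exhausts_rhs c)) := by
    rw [← map_sum, ← map_sub]
    congr!
  have hN : (corolla n m).numAngles = 2 * n + 1 := by
    rw [corolla, numAngles, numAnglesForest_leaves, List.length_finRange, add_comm]
  have hm : (leaves n m).length = m := by rw [leaves, List.length_map, List.length_finRange]
  have hs : ∑ c : Decomposition n m, APE.sumOf (rhs c).eval = APE.sumOf (lhs n m).eval := by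
    rw [eval_lhs, ← bind_monoSeqs_graft, hN, hm, APE.sumOf_bind, ← sum_monotone m (2 * n + 1)
      fun fs => APE.sumOf {graft (fiber (leaves n m) fs) (corolla n m)}]
    refine Fintype.sum_congr _ _ fun c => ?_
    rw [eval_rhs]
  simp only [APE.evalApp_of] at h
  rw [h, hs, sub_self]

end BraceRelation

theorem APE.evalApp_eq_zero {I : Type} [Finite I] {p : (FreeOperad braceArity).obj I}
    (hp : p ∈ braceIdeal.carrier I) : APE.evalApp I p = 0 := by
  refine APE.evalHom.app_eq_zero_of_spanMem ?_ hp
  rintro I _ p ⟨n, m⟩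
  exact BraceRelation.evalApp_relator

/-! ### Planar trees as brace terms -/

namespace PlanarTree

open OpTerm

variable {V : Type}

mutual
/-- The brace term of a planar tree. -/
def toTerm : PlanarTree V → OpTerm braceArity V
  | node v ts => brace (var v) (toTerms ts)
/-- The brace terms of a forest. -/
def toTerms : List (PlanarTree V) → List (OpTerm braceArity V)
  | [] => []
  | t :: ts => toTerm t :: toTerms ts
end

mutual
-- Grafting a forest on a one-vertex tree allows only one result, since there is only one angle.
-- Thus `toTerm` is a section of the evaluation.
theorem eval_toTerm : ∀ t : PlanarTree V, t.toTerm.eval = {t}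
  | node v ts => by
    rw [toTerm, eval_brace, eval_toTerms ts, eval]
    simp only [Multiset.singleton_bind, insT_leaf]
theorem eval_toTerms : ∀ ts : List (PlanarTree V), listProd ((toTerms ts).map eval) = {ts}
  | [] => rfl
  | t :: ts => by
    rw [toTerms, List.map_cons, listProd, eval_toTerm t, eval_toTerms ts, Multiset.singleton_bind,
      Multiset.singleton_bind]
end

theorem exhausts_toTerm {t : PlanarTree V} (ht : Exhausts t.labels) : Exhausts t.toTerm.vars :=
  ht.perm (labels_of_mem_eval (by rw [eval_toTerm]; exact Multiset.mem_singleton_self t)).symm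

end PlanarTree

/-- The linear map that sends a tree to its brace term. -/
noncomputable def APE.toFree (I : Type) [Finite I] : APE.obj I →+ (FreeOperad braceArity).obj I :=
  FreeAbelianGroup.lift fun T : PlanarTreeOn I =>
    FreeOperad.of T.1.toTerm (PlanarTree.exhausts_toTerm T.2)

theorem APE.toFree_of {I : Type} [Finite I] (T : PlanarTree I) (hT : Exhausts T.labels) :
    APE.toFree I (APE.of T hT) = FreeOperad.of T.toTerm (PlanarTree.exhausts_toTerm hT) :=
  FreeAbelianGroup.lift_apply_of _ _

theorem APE.evalApp_toFree {I : Type} [Finite I] (q : APE.obj I) :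
    APE.evalApp I (APE.toFree I q) = q := by
  refine APE.induction (fun t ht => ?_) (fun p h => ?_) (fun p q h₁ h₂ => ?_) ?_ q
  · rw [toFree_of, evalApp_of, PlanarTree.eval_toTerm, sumOf_singleton, proj_eq ht]
  · simp only [map_neg, h]
  · simp only [map_add, h₁, h₂]
  · simp only [map_zero]

/-! ### Simultaneous substitution in an operadic ideal -/

theorem Exhausts.perm_of_exhausts {V : Type} {l l' : List V} (h : Exhausts l) (h' : Exhausts l') :
    l.Perm l' :=
  (List.perm_ext_iff_of_nodup h.1 h'.1).2 fun v => ⟨fun _ => h'.2 v, fun _ => h.2 v⟩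

namespace OpTerm

variable {G : Type} {ar : G → ℕ} {V : Type}

theorem mem_vars_op {g : G} {ts : Fin (ar g) → OpTerm ar V} {v : V} :
    v ∈ (op g ts).vars ↔ ∃ i, v ∈ (ts i).vars := by
  simp [vars, List.mem_flatten]

theorem exists_rename_val {P : V → Prop} {t : OpTerm ar V} (h : ∀ v ∈ t.vars, P v) :
    ∃ s : OpTerm ar {v // P v}, s.rename Subtype.val = t := by
  induction t with
  | var v => exact ⟨var ⟨v, h v (by simp [vars])⟩, rfl⟩
  | op g ts ih =>
    choose s hs using fun i => ih i fun v hv => h v (mem_vars_op.2 ⟨i, hv⟩)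
    refine ⟨op g s, ?_⟩
    rw [rename, subst]
    exact congrArg _ (funext hs)

theorem vars_op_eq_flatMap (g : G) (ts : Fin (ar g) → OpTerm ar V) :
    (op g ts).vars = (List.finRange (ar g)).flatMap fun i => (ts i).vars := by
  rw [vars, List.ofFn_eq_map, List.flatMap_def]

end OpTerm

namespace FreeOperad

open OpTerm

variable {G : Type} {ar : G → ℕ} {V : Type}

/-- Simultaneous substitution of terms for the variables of the elements of the free operad. -/
noncomputable def substApp {J : Type} [Finite J] (f : J → OpTerm ar V) :
    (FreeOperad ar).obj J →+ FreeAbelianGroup (OpTerm ar V) :=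
  FreeAbelianGroup.map fun t : MultilinearTerm ar J => t.1.subst f

theorem substApp_of {J : Type} [Finite J] (f : J → OpTerm ar V) (t : OpTerm ar J)
    (ht : Exhausts t.vars) : substApp f (of t ht) = FreeAbelianGroup.of (t.subst f) :=
  FreeAbelianGroup.map_of_apply _

open Classical in
/-- The element of the free operad given by a term, and `0` if the term is not multilinear. -/
noncomputable def projTerm [Finite V] (t : OpTerm ar V) : (FreeOperad ar).obj V :=
  if h : Exhausts t.vars then of t h else 0

theorem projTerm_eq [Finite V] {t : OpTerm ar V} (h : Exhausts t.vars) : projTerm t = of t h :=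
  dif_pos h

/-- The projection from sums of terms to sums of multilinear terms. -/
noncomputable def projApp [Finite V] :
    FreeAbelianGroup (OpTerm ar V) →+ (FreeOperad ar).obj V :=
  FreeAbelianGroup.lift projTerm

theorem projApp_of [Finite V] (t : OpTerm ar V) :
    projApp (FreeAbelianGroup.of t) = projTerm t := FreeAbelianGroup.lift_apply_of _ _

/-- A simultaneous substitution whose value at `j` has shape `s` factors through the partial
composition with `s` at `j`. -/
theorem substApp_comp {J I : Type} [Finite J] [Finite I] (f : J → OpTerm ar V) (j : J)
    {s : OpTerm ar I} (hs : Exhausts s.vars) (f' : {x : J // x ≠ j} ⊕ I → OpTerm ar V)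
    (h₁ : ∀ x, f' (.inl x) = f x.1) (h₂ : s.subst (fun i => f' (.inr i)) = f j)
    (p : (FreeOperad ar).obj J) :
    substApp f' ((FreeOperad ar).comp j p (of s hs)) = substApp f p := by
  refine induction (fun t ht => ?_) (fun p h => ?_) (fun p q h₁ h₂ => ?_) ?_ p
  · rw [comp_of, substApp_of, substApp_of, insertAt, subst_subst]
    congr 2
    funext x
    by_cases hx : x = j
    · subst hx
      rw [dif_pos rfl, rename, subst_subst, ← h₂]
      rfl
    · rw [dif_neg hx]
      exact h₁ ⟨x, hx⟩
  · simp only [map_neg, h, AddMonoidHom.neg_apply]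
  · simp only [map_add, h₁, h₂, AddMonoidHom.add_apply]
  · simp only [map_zero, AddMonoidHom.zero_apply]

theorem projApp_substApp_var {J : Type} [Finite J] [Finite V] (e : J ≃ V)
    (p : (FreeOperad ar).obj J) :
    projApp (substApp (fun j => var (e j)) p) = (FreeOperad ar).map e p := by
  refine induction (fun t ht => ?_) (fun p h => ?_) (fun p q h₁ h₂ => ?_) ?_ p
  · rw [substApp_of, projApp_of, map_of]
    exact projTerm_eq (exhausts_rename e ht)
  · simp only [map_neg, h]
  · simp only [map_add, h₁, h₂]
  · simp only [map_zero]

/-- The induction is on the number of entries that receive something other than a variable. If there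
are none, multilinearity makes `f` a relabelling by a bijection. Otherwise one such entry is
absorbed by a partial composition, under which the ideal is stable. -/
theorem projApp_substApp_mem_aux (N : (FreeOperad ar).Ideal) [Finite V] (n : ℕ) :
    ∀ (J : Type) [Finite J] (f : J → OpTerm ar V), {j | ∀ v, f j ≠ var v}.ncard = n →
      ∀ l : List J, Exhausts l → Exhausts (l.flatMap fun j => (f j).vars) →
      ∀ p ∈ N.carrier J, projApp (substApp f p) ∈ N.carrier V := by
  classical
  induction n with
  | zero =>
    intro J _ f hn l hl hf p hp
    rw [Set.ncard_eq_zero (Set.toFinite _), Set.eq_empty_iff_forall_notMem] at hn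
    have h : ∀ j, ∃ v, f j = var v := fun j => by simpa using hn j
    choose e he using h
    obtain rfl : f = fun j => var (e j) := funext he
    have hf' : Exhausts (l.map e) := by
      simpa only [vars, ← List.map_eq_flatMap] using hf
    have hb : Function.Bijective e := by
      refine ⟨fun a b hab => ?_, fun v => ?_⟩
      · exact List.inj_on_of_nodup_map hf'.1 (hl.2 a) (hl.2 b) hab
      · obtain ⟨j, -, hj⟩ := List.mem_map.1 (hf'.2 v)
        exact ⟨j, hj⟩
    have h := projApp_substApp_var (Equiv.ofBijective e hb) p
    rw [show (fun j => var (e j) : J → OpTerm ar V) =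
      fun j => var (Equiv.ofBijective e hb j) from rfl, h]
    exact N.map_mem _ hp
  | succ n ih =>
    intro J _ f hn l hl hf p hp
    obtain ⟨j, hj⟩ : {j | ∀ v, f j ≠ var v}.Nonempty :=
      Set.nonempty_of_ncard_ne_zero (by omega)
    -- Over the set of its own variables the term `f j` is multilinear, so it can be composed at
    -- `j`; its variables become the new entries.
    obtain ⟨s, hs⟩ := exists_rename_val (P := fun v => v ∈ (f j).vars) fun v hv => hv
    have hvs : s.vars.map Subtype.val = (f j).vars :=
      (vars_rename _ _).symm.trans (congrArg vars hs)
    have hse : Exhausts s.vars := by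
      refine ⟨List.Nodup.of_map Subtype.val ?_, fun v => ?_⟩
      · rw [hvs]
        exact (List.nodup_flatMap.1 hf.1).1 j (hl.2 j)
      · obtain ⟨w, hw, hwv⟩ := List.mem_map.1 ((congrArg (v.1 ∈ ·) hvs).mpr v.2)
        rwa [← Subtype.ext hwv]
    let f' : {x : J // x ≠ j} ⊕ {v // v ∈ (f j).vars} → OpTerm ar V :=
      Sum.elim (fun x => f x.1) fun v => var v.1
    rw [← substApp_comp f j hse f' (fun _ => rfl) hs]
    refine ih _ f' ?_ (replaceAt j s.vars l) (hl.replaceAt hse j) ?_ _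
      (N.comp_mem_left j _ hp)
    -- The new entries receive variables, so the count loses exactly `j`.
    · have h : {x | ∀ v, f' x ≠ var v} =
          Sum.inl '' ((Subtype.val : {x : J // x ≠ j} → J) ⁻¹' {j | ∀ v, f j ≠ var v}) := by
        ext x
        rcases x with x | v
        · simp [f']
        · simp [f']
      have h' : Subtype.val '' ((Subtype.val : {x : J // x ≠ j} → J) ⁻¹' {j | ∀ v, f j ≠ var v}) =
          {j | ∀ v, f j ≠ var v} \ {j} := by
        ext x
        simp [and_comm]
      rw [h, Set.ncard_image_of_injective _ Sum.inl_injective,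
        ← Set.ncard_image_of_injective _ Subtype.val_injective, h',
        Set.ncard_sdiff_singleton_of_mem hj, hn, Nat.add_sub_cancel]
    · have h : ((replaceAt j s.vars l).flatMap fun x => (f' x).vars) =
          l.flatMap fun j => (f j).vars := by
        rw [replaceAt, List.flatMap_assoc]
        congr 1
        funext x
        by_cases hx : x = j
        · subst hx
          refine Eq.trans ?_ hvs
          rw [dif_pos rfl, List.flatMap_map, List.map_eq_flatMap]
          rfl
        · rw [dif_neg hx]
          simp [f']
      rw [h]
      exact hf

theorem projApp_substApp_mem (N : (FreeOperad ar).Ideal) [Finite V] {J : Type} [Finite J]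
    (f : J → OpTerm ar V) {p : (FreeOperad ar).obj J} (hp : p ∈ N.carrier J) :
    projApp (substApp f p) ∈ N.carrier V := by
  by_cases h : ∃ l : List J, Exhausts l ∧ Exhausts (l.flatMap fun j => (f j).vars)
  · obtain ⟨l, hl, hf⟩ := h
    exact projApp_substApp_mem_aux N _ J f rfl l hl hf p hp
  -- If some term became multilinear after substitution, its own variables would provide the
  -- excluded enumeration `l`.
  · have h0 : projApp (substApp f p) = 0 := by
      refine induction (fun t ht => ?_) (fun p h => ?_) (fun p q h₁ h₂ => ?_) ?_ p
      · rw [substApp_of, projApp_of, projTerm, dif_neg]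
        intro h'
        rw [vars_subst] at h'
        exact h ⟨_, ht, h'⟩
      · rw [map_neg, map_neg, h, neg_zero]
      · rw [map_add, map_add, h₁, h₂, add_zero]
      · rw [map_zero, map_zero]
    rw [h0]
    exact zero_mem _

/-- The subgroup of the sums of terms generated by the results of substitutions in the elements of
an ideal. -/
def substClosure (N : (FreeOperad ar).Ideal) (V : Type) :
    AddSubgroup (FreeAbelianGroup (OpTerm ar V)) :=
  AddSubgroup.closure {x | ∃ (J : Type) (_ : Finite J) (p : (FreeOperad ar).obj J)
    (f : J → OpTerm ar V), p ∈ N.carrier J ∧ substApp f p = x}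

theorem projApp_mem (N : (FreeOperad ar).Ideal) [Finite V] {x : FreeAbelianGroup (OpTerm ar V)}
    (hx : x ∈ substClosure N V) : projApp x ∈ N.carrier V := by
  have h : substClosure N V ≤ (N.carrier V).comap projApp := by
    refine (AddSubgroup.closure_le _).2 ?_
    rintro _ ⟨J, _, p, f, hp, rfl⟩
    exact projApp_substApp_mem N f hp
  exact h hx

/-- This lets a relation be applied inside an argument of `g`. The other arguments are arbitrary
terms, which is why the closure is taken without a multilinearity condition. -/
theorem map_op_mem (N : (FreeOperad ar).Ideal) (g : G) (ts : Fin (ar g) → OpTerm ar V)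
    (i : Fin (ar g)) {x : FreeAbelianGroup (OpTerm ar V)} (hx : x ∈ substClosure N V) :
    FreeAbelianGroup.map (fun s => op g (Function.update ts i s)) x ∈ substClosure N V := by
  have h : substClosure N V ≤ (substClosure N V).comap
      (FreeAbelianGroup.map fun s => op g (Function.update ts i s)) := by
    refine (AddSubgroup.closure_le _).2 ?_
    rintro _ ⟨J, _, p, f, hp, rfl⟩
    -- The generator composed at `i` with `p` still lies in the ideal; its remaining entries are
    -- then filled with the fixed arguments.
    refine AddSubgroup.subset_closure ⟨_, inferInstance, (FreeOperad ar).comp i (gen ar g) p,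
      Sum.elim (fun k => ts k.1) f, N.comp_mem_right i _ hp, ?_⟩
    clear hp
    have hg : ∃ h, gen ar g = of (op g var) h := ⟨_, rfl⟩
    obtain ⟨hv, hg⟩ := hg
    rw [hg]
    refine induction (fun t ht => ?_) (fun p h => ?_) (fun p q h₁ h₂ => ?_) ?_ p
    · rw [comp_of, substApp_of, substApp_of, FreeAbelianGroup.map_of_apply, insertAt, subst_subst,
        subst]
      congr 2
      funext k
      by_cases hk : k = i
      · subst hk
        rw [subst, dif_pos rfl, Function.update_self, rename, subst_subst]
        rfl
      · rw [subst, dif_neg hk, Function.update_of_ne hk]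
        rfl
    · simp only [map_neg, h]
    · simp only [map_add, h₁, h₂]
    · simp only [map_zero]
  exact h hx

end FreeOperad

/-! ### Reduction of brace terms to planar trees -/

namespace OpTerm

variable {V W : Type}

theorem op_eq_op {g h : ℕ+} {ts : Fin (braceArity g) → OpTerm braceArity V}
    {us : Fin (braceArity h) → OpTerm braceArity V} (e : List.ofFn ts = List.ofFn us) :
    op g ts = op h us := by
  have hl : braceArity g = braceArity h := by simpa using congrArg List.length e
  obtain rfl : g = h := PNat.eq (Nat.succ_injective hl)
  rw [List.ofFn_injective e]

theorem op_eq_brace (g : ℕ+) (ts : Fin (braceArity g) → OpTerm braceArity V) :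
    op g ts = brace (ts ⟨0, Nat.succ_pos _⟩) (List.ofFn fun i : Fin g => ts i.succ) := by
  have h : List.ofFn ts = ts ⟨0, Nat.succ_pos _⟩ :: List.ofFn fun i : Fin g => ts i.succ :=
    List.ofFn_succ (n := g)
  generalize hl : (List.ofFn fun i : Fin g => ts i.succ) = l at h ⊢
  cases l with
  | nil =>
    have := congrArg List.length hl
    simp at this
  | cons t l =>
    refine op_eq_op (h.trans ?_)
    exact (List.ofFn_get _).symm

theorem brace_subst (f : V → OpTerm braceArity W) (t : OpTerm braceArity V)
    (l : List (OpTerm braceArity V)) :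
    (brace t l).subst f = brace (t.subst f) (l.map fun s => s.subst f) := by
  cases l with
  | nil => rfl
  | cons s l =>
    refine op_eq_op ?_
    refine Eq.trans ?_ (List.ofFn_get (t.subst f :: s.subst f :: l.map fun s => s.subst f)).symm
    refine Eq.trans ?_ (congrArg (List.map fun s => s.subst f) (List.ofFn_get (t :: s :: l)))
    rw [List.map_ofFn]
    rfl

/-- A weight of the brace terms that decreases when a brace relation is applied. -/
def weight : OpTerm braceArity V → ℕ
  | var _ => 1
  | op _ ts => (ts ⟨0, Nat.succ_pos _⟩).weight + ∑ i, (ts i).weight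

theorem weight_pos (t : OpTerm braceArity V) : 0 < t.weight := by
  induction t with
  | var v => exact Nat.one_pos
  | op _ ts ih => exact Nat.add_pos_left (ih _) _

theorem weight_brace (t : OpTerm braceArity V) {l : List (OpTerm braceArity V)} (hl : l ≠ []) :
    (brace t l).weight = 2 * t.weight + (l.map weight).sum := by
  cases l with
  | nil => exact absurd rfl hl
  | cons s l =>
    have h : (brace t (s :: l)).weight =
        t.weight + ∑ i : Fin (t :: s :: l).length, ((t :: s :: l).get i).weight := rfl
    rw [h, ← List.sum_ofFn, two_mul, add_assoc]
    congr 1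
    have h' : (List.ofFn fun i => ((t :: s :: l).get i).weight) = (t :: s :: l).map weight := by
      conv_rhs => rw [← List.ofFn_get (t :: s :: l), List.map_ofFn]
      rfl
    rw [h', List.map_cons, List.sum_cons]

/-- Equality fails for the empty list, where the brace is `t` itself; the intervals of a brace
relation may be empty, so the bound must cover this case. -/
theorem weight_brace_le (t : OpTerm braceArity V) (l : List (OpTerm braceArity V)) :
    (brace t l).weight ≤ 2 * t.weight + (l.map weight).sum := by
  cases l with
  | nil =>
    simp only [brace, List.map_nil, List.sum_nil]
    omega
  | cons s l => exact (weight_brace t (List.cons_ne_nil s l)).le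

theorem weight_update_lt (g : ℕ+) (ts : Fin (braceArity g) → OpTerm braceArity V)
    (i : Fin (braceArity g)) {s : OpTerm braceArity V} (h : s.weight < (ts i).weight) :
    (op g (Function.update ts i s)).weight < (op g ts).weight := by
  have hle : ∀ k, (Function.update ts i s k).weight ≤ (ts k).weight := fun k => by
    by_cases hk : k = i
    · subst hk
      rw [Function.update_self]
      exact h.le
    · rw [Function.update_of_ne hk]
  refine Nat.add_lt_add_of_le_of_lt (hle _) ?_
  refine Finset.sum_lt_sum (fun k _ => hle k) ⟨i, Finset.mem_univ i, ?_⟩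
  rwa [Function.update_self]

theorem vars_update_perm (g : ℕ+) (ts : Fin (braceArity g) → OpTerm braceArity V)
    (i : Fin (braceArity g)) {s : OpTerm braceArity V} (h : s.vars.Perm (ts i).vars) :
    (op g (Function.update ts i s)).vars.Perm (op g ts).vars := by
  rw [vars_op_eq_flatMap, vars_op_eq_flatMap]
  refine List.Perm.flatMap_left _ fun k _ => ?_
  by_cases hk : k = i
  · subst hk
    rwa [Function.update_self]
  · rw [Function.update_of_ne hk]

end OpTerm

-- Brace relations decrease the weight

namespace BraceRelation

open OpTerm

variable {V : Type} {n m : ℕ}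

theorem vars_lhs : (lhs n m).vars =
    Sum.inl () :: ((List.finRange n).map (fun i => Sum.inr (Sum.inl i)) ++
      (List.finRange m).map (fun i => Sum.inr (Sum.inr i))) := by
  simp [lhs, vars_brace, z, x, y, OpTerm.vars, List.flatMap_map, ← List.map_eq_flatMap]

theorem weight_Y (f : BraceVar n m → OpTerm braceArity V) (c : Decomposition n m) (k : ℕ) :
    ((Y c k).map fun t => (t.subst f).weight).sum =
      (((Y c k).flatMap vars).map fun v => (f v).weight).sum := by
  rw [vars_Y, Y, List.map_map, List.map_map]
  rfl

/-- The entry `z` and each `x_i` stand first in at most one brace and count at most twice; each `y`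
counts once. The last sum counts all variables once, and the other two account for the second
counts. -/
theorem weight_rhs_le (f : BraceVar n m → OpTerm braceArity V) (c : Decomposition n m) :
    ((rhs c).subst f).weight ≤ (f (Sum.inl ())).weight +
      ((List.finRange n).map fun i => (f (Sum.inr (Sum.inl i))).weight).sum +
        ((rhs c).vars.map fun v => (f v).weight).sum := by
  have h : ∀ l : List (Fin n),
      ((l.flatMap fun i => brace (x i) (Y c (2 * i + 1)) :: Y c (2 * i + 2)).map
        fun t => (t.subst f).weight).sum ≤
      (l.map fun i => (f (Sum.inr (Sum.inl i))).weight).sum +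
        ((l.flatMap fun i => (Sum.inr (Sum.inl i) : BraceVar n m) ::
          ((Y c (2 * i + 1)).flatMap OpTerm.vars ++
            (Y c (2 * i + 2)).flatMap OpTerm.vars)).map fun v => (f v).weight).sum := fun l => by
    induction l with
    | nil => simp
    | cons i l ih =>
      have hb := weight_brace_le (f (Sum.inr (Sum.inl i)))
        ((Y c (2 * i + 1)).map fun s => s.subst f)
      rw [List.map_map] at hb
      have h₁ := weight_Y f c (2 * i + 1)
      have h₂ := weight_Y f c (2 * i + 2)
      simp only [List.flatMap_cons, List.map_cons, List.map_append, List.sum_append,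
        List.sum_cons, brace_subst, List.cons_append, x, subst, Function.comp_def] at ih hb ⊢
      omega
  have hz := weight_brace_le (f (Sum.inl ())) ((Y c 0 ++ (List.finRange n).flatMap fun i =>
    brace (x i) (Y c (2 * i + 1)) :: Y c (2 * i + 2)).map fun s => s.subst f)
  have h₀ := weight_Y f c 0
  have h' := h (List.finRange n)
  rw [List.map_map] at hz
  rw [vars_rhs, List.map_cons, List.sum_cons, List.map_append, List.sum_append, rhs, brace_subst, z,
    subst]
  simp only [Function.comp_def, List.map_append, List.sum_append] at hz ⊢
  omega

/-- Writing letters for weights, the left side weighs `4z + 2∑x + ∑y` when both lists are nonempty,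
against at most `2z + 2∑x + ∑y` on the right, and `z` is positive. -/
theorem weight_rhs_lt (f : BraceVar n m → OpTerm braceArity V) (c : Decomposition n m) (hn : 0 < n)
    (hm : 0 < m) : ((rhs c).subst f).weight < ((lhs n m).subst f).weight := by
  have h := weight_rhs_le f c
  have hp : ((rhs c).vars.map fun v => (f v).weight).sum =
      ((lhs n m).vars.map fun v => (f v).weight).sum :=
    (((exhausts_rhs c).perm_of_exhausts (exhausts_lhs n m)).map _).sum_eq
  have hz := weight_pos (f (Sum.inl ()))
  rw [hp, vars_lhs] at h
  rw [lhs, brace_subst, brace_subst, weight_brace, weight_brace]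
  · simp only [List.map_cons, List.map_append, List.sum_append, List.sum_cons, List.map_map,
      Function.comp_def, x, y, z, subst] at h ⊢
    omega
  · simp [← List.length_eq_zero_iff, hn.ne']
  · simp [← List.length_eq_zero_iff, hm.ne']

theorem lhs_subst (t : OpTerm braceArity V) (xs ys : List (OpTerm braceArity V)) :
    (lhs xs.length ys.length).subst (Sum.elim (fun _ => t) (Sum.elim xs.get ys.get)) =
      brace (brace t xs) ys := by
  rw [lhs, brace_subst, brace_subst, List.map_map, List.map_map]
  congr 1
  · congr 1
    exact List.map_get_finRange xs
  · exact List.map_get_finRange ys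

theorem substApp_relator (f : BraceVar n m → OpTerm braceArity V) :
    FreeOperad.substApp f (relator n m) = FreeAbelianGroup.of ((lhs n m).subst f) -
      ((Finset.univ.val.map fun c : Decomposition n m => (rhs c).subst f).map
        FreeAbelianGroup.of).sum := by
  have h : relator n m = FreeOperad.of (lhs n m) (exhausts_lhs n m) -
        ∑ c : Decomposition n m, FreeOperad.of (rhs c) (exhausts_rhs c) := by
    rw [relator]
    congr!
  rw [h, map_sub, map_sum, Multiset.map_map]
  simp only [FreeOperad.substApp_of]
  rfl

end BraceRelation

namespace PlanarTree

theorem toTerms_eq_map {V : Type} (ts : List (PlanarTree V)) : toTerms ts = ts.map toTerm := by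
  induction ts with
  | nil => rfl
  | cons t ts ih => rw [toTerms, ih, List.map_cons]

end PlanarTree

open OpTerm BraceRelation FreeOperad in
/-- A brace term is the term of a planar tree, or a relation replaces it by a sum of terms of
smaller weight. -/
theorem exists_reduction {V : Type} (t : OpTerm braceArity V) :
    (∃ T : PlanarTree V, T.toTerm = t) ∨ ∃ M : Multiset (OpTerm braceArity V),
      (∀ s ∈ M, s.weight < t.weight ∧ s.vars.Perm t.vars) ∧
        FreeAbelianGroup.of t - (M.map FreeAbelianGroup.of).sum ∈ substClosure braceIdeal V := by
  induction t with
  | var v => exact Or.inl ⟨.node v [], rfl⟩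
  | op g ts ih =>
    by_cases h : ∀ i, ∃ T : PlanarTree V, T.toTerm = ts i
    · choose T hT using h
      obtain ⟨v, us, h₀⟩ : ∃ v us, T ⟨0, Nat.succ_pos _⟩ = .node v us := by
        cases T ⟨0, Nat.succ_pos _⟩ with
        | node v us => exact ⟨v, us, rfl⟩
      have hv := hT ⟨0, Nat.succ_pos _⟩
      rw [h₀, PlanarTree.toTerm] at hv
      have hl : (List.ofFn fun i : Fin g => ts i.succ) =
          PlanarTree.toTerms (List.ofFn fun i : Fin g => T i.succ) := by
        rw [PlanarTree.toTerms_eq_map, List.map_ofFn]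
        exact congrArg List.ofFn (funext fun i => (hT i.succ).symm)
      -- The arguments are tree terms, and the first has root `v`. If that first tree is a single
      -- vertex, the whole term is a tree term; otherwise it is the left side of a brace relation
      -- with `z = v`.
      cases us with
      | nil =>
        refine Or.inl ⟨.node v (List.ofFn fun i : Fin g => T i.succ), ?_⟩
        rw [op_eq_brace, ← hv, hl]
        rfl
      | cons u us =>
        right
        have ht : op g ts = (lhs _ _).subst _ :=
          (op_eq_brace g ts).trans ((congrArg (brace · _) hv.symm).trans (lhs_subst _ _ _).symm)
        have hn : 0 < (PlanarTree.toTerms (u :: us)).length := by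
          rw [PlanarTree.toTerms]
          exact Nat.succ_pos _
        have hm : 0 < (List.ofFn fun i : Fin g => ts i.succ).length := by
          rw [List.length_ofFn]
          exact g.2
        refine ⟨_, ?_, AddSubgroup.subset_closure ⟨_, inferInstance, _, _, ?_,
          (substApp_relator _).trans (by rw [ht])⟩⟩
        · intro s hs
          obtain ⟨c, -, rfl⟩ := Multiset.mem_map.1 hs
          rw [ht]
          refine ⟨weight_rhs_lt _ c hn hm, ?_⟩
          rw [vars_subst, vars_subst]
          exact ((exhausts_rhs c).perm_of_exhausts (exhausts_lhs _ _)).flatMap_right _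
        · exact OperadData.SpanMem.of _ (Relators.mk ⟨_, hn⟩ ⟨_, hm⟩)
    -- Some argument is not a tree term: it is reduced in place, and the weight is strictly monotone
    -- in each argument.
    · push Not at h
      obtain ⟨i, hi⟩ := h
      right
      obtain ⟨T, hT⟩ | ⟨M, hM, hmem⟩ := ih i
      · exact absurd hT (hi T)
      · refine ⟨M.map fun s => op g (Function.update ts i s), ?_, ?_⟩
        · intro s hs
          obtain ⟨s', hs', rfl⟩ := Multiset.mem_map.1 hs
          exact ⟨weight_update_lt g ts i (hM s' hs').1, vars_update_perm g ts i (hM s' hs').2⟩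
        · have h := map_op_mem braceIdeal g ts i hmem
          rw [map_sub, map_multiset_sum, Multiset.map_map, FreeAbelianGroup.map_of_apply,
            Function.update_eq_self] at h
          rw [Multiset.map_map]
          convert h using 4
          exact (FreeAbelianGroup.map_of_apply _).symm

open FreeOperad in
/-- Modulo the brace relations, the multilinear terms are sums of terms of planar trees. -/
theorem of_sub_toFree_mem {V : Type} [Finite V] (t : OpTerm braceArity V) (ht : Exhausts t.vars) :
    ∃ q : APE.obj V, of t ht - APE.toFree V q ∈ braceIdeal.carrier V := by
  induction hw : t.weight using Nat.strong_induction_on generalizing t with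
  | _ w ih =>
    subst hw
    obtain ⟨T, rfl⟩ | ⟨M, hM, hmem⟩ := exists_reduction t
    · have hT : Exhausts T.labels := ht.perm
        (OpTerm.labels_of_mem_eval (by
          rw [PlanarTree.eval_toTerm]
          exact Multiset.mem_singleton_self T))
      refine ⟨APE.of T hT, ?_⟩
      rw [APE.toFree_of, sub_self]
      exact zero_mem _
    · have h := projApp_mem braceIdeal hmem
      rw [map_sub, projApp_of, projTerm_eq ht, map_multiset_sum, Multiset.map_map] at h
      -- Every term of `M` is lighter and has the same variables up to order, so it stays
      -- multilinear and the induction on weight applies; the resulting sums of trees are added up.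
      have key : ∀ M' : Multiset (OpTerm braceArity V), (∀ s ∈ M', s ∈ M) → ∃ q : APE.obj V,
          (M'.map fun s => projApp (FreeAbelianGroup.of s)).sum - APE.toFree V q ∈
            braceIdeal.carrier V := fun M' => by
        induction M' using Multiset.induction_on with
        | empty =>
          intro _
          refine ⟨0, ?_⟩
          rw [Multiset.map_zero, Multiset.sum_zero, map_zero, sub_zero]
          exact zero_mem _
        | cons s M' ihM =>
          intro hs
          obtain ⟨q, hq⟩ := ihM fun s' hs' => hs s' (Multiset.mem_cons_of_mem hs')
          obtain ⟨hw, hp⟩ := hM s (hs s (Multiset.mem_cons_self s M'))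
          obtain ⟨q', hq'⟩ := ih _ hw s (ht.perm hp) rfl
          refine ⟨q' + q, ?_⟩
          rw [Multiset.map_cons, Multiset.sum_cons, projApp_of, projTerm_eq (ht.perm hp), map_add,
            add_sub_add_comm]
          exact add_mem hq' hq
      obtain ⟨q, hq⟩ := key M fun _ h => h
      refine ⟨q, ?_⟩
      have h' := add_mem h hq
      simp only [Function.comp_def, sub_add_sub_cancel] at h'
      exact h'

theorem exists_sub_toFree_mem {V : Type} [Finite V] (p : (FreeOperad braceArity).obj V) :
    ∃ q : APE.obj V, p - APE.toFree V q ∈ braceIdeal.carrier V := by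
  refine FreeOperad.induction (fun t ht => ?_) (fun p h => ?_) (fun p q h₁ h₂ => ?_) ?_ p
  · exact of_sub_toFree_mem t ht
  · obtain ⟨q, hq⟩ := h
    refine ⟨-q, ?_⟩
    rw [map_neg, ← neg_sub']
    exact neg_mem hq
  · obtain ⟨q₁, hq₁⟩ := h₁
    obtain ⟨q₂, hq₂⟩ := h₂
    refine ⟨q₁ + q₂, ?_⟩
    rw [map_add, add_sub_add_comm]
    exact add_mem hq₁ hq₂
  · refine ⟨0, ?_⟩
    rw [map_zero, sub_zero]
    exact zero_mem _

-- The kernel of the evaluation and the isomorphism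

/-- Modulo the ideal, `p` is the term of some sum of trees `q`, and `q` is then the value of `p`. If
this value vanishes, so does `q`, and `p` lies in the ideal. -/
theorem mem_braceIdeal_iff {V : Type} [Finite V] {p : (FreeOperad braceArity).obj V} :
    p ∈ braceIdeal.carrier V ↔ APE.evalApp V p = 0 := by
  refine ⟨APE.evalApp_eq_zero, fun h => ?_⟩
  obtain ⟨q, hq⟩ := exists_sub_toFree_mem p
  have h' := APE.evalApp_eq_zero hq
  rw [map_sub, h, APE.evalApp_toFree, zero_sub, neg_eq_zero] at h'
  rwa [h', map_zero, sub_zero] at hq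

theorem APE.evalApp_surjective (I : Type) [Finite I] : Function.Surjective (APE.evalApp I) :=
  fun q => ⟨APE.toFree I q, APE.evalApp_toFree q⟩

/-- The isomorphism from Brace to APE. -/
noncomputable def braceEquiv (I : Type) [Finite I] : Brace.obj I ≃+ APE.obj I :=
  AddEquiv.ofBijective
    (QuotientAddGroup.lift (braceIdeal.carrier I) (APE.evalApp I) fun _ h => APE.evalApp_eq_zero h)
    ⟨(injective_iff_map_eq_zero _).2 fun p hp => by
      obtain ⟨p, rfl⟩ := (FreeOperad braceArity).toQuotient_surjective braceIdeal I p
      exact (OperadData.toQuotient_eq_zero _ _).2 (mem_braceIdeal_iff.2 hp),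
    fun q => ⟨(FreeOperad braceArity).toQuotient braceIdeal I (APE.toFree I q),
      APE.evalApp_toFree q⟩⟩

/-- The isomorphism of operads from Brace to APE. -/
noncomputable def braceIso : OperadData.Iso Brace APE where
  equiv I _ := braceEquiv I
  equiv_map {I J} _ _ e p := by
    obtain ⟨p, rfl⟩ := (FreeOperad braceArity).toQuotient_surjective braceIdeal I p
    exact APE.evalHom.app_map e p
  equiv_one := APE.evalHom.app_one
  equiv_comp {J I} _ _ j p q := by
    obtain ⟨p, rfl⟩ := (FreeOperad braceArity).toQuotient_surjective braceIdeal J p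
    obtain ⟨q, rfl⟩ := (FreeOperad braceArity).toQuotient_surjective braceIdeal I q
    exact APE.evalHom.app_comp j p q

/-- On variables, `C_n` grafts `n` one-vertex trees into the only angle of the one-vertex tree `0`,
which produces the corolla. -/
theorem evalApp_gen (n : ℕ+) :
    APE.evalApp (Fin (n + 1)) (FreeOperad.gen braceArity n) = APE.Corl n := by
  have h : (OpTerm.op n OpTerm.var : OpTerm braceArity (Fin (n + 1))).eval =
      {(PlanarTreeOn.corolla n).1} := by
    have hl : listProd (List.ofFn fun i : Fin n =>
        (OpTerm.var i.succ : OpTerm braceArity (Fin (n + 1))).eval) =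
          {(List.finRange n).map fun i => PlanarTree.node i.succ []} := by
      rw [← OpTerm.listProd_map_var, List.map_map, List.ofFn_eq_map]
      rfl
    refine Eq.trans ?_ ((congrArg (fun m => m.bind fun us =>
      PlanarTree.insT (PlanarTree.node (0 : Fin (n + 1)) []) us) hl).trans ?_)
    · exact Multiset.singleton_bind _ _
    · rw [Multiset.singleton_bind, PlanarTree.insT_leaf]
      rfl
  refine (FreeAbelianGroup.lift_apply_of _ _).trans ?_
  refine (congrArg APE.sumOf h).trans ?_
  rw [APE.sumOf_singleton, APE.proj_eq (PlanarTreeOn.corolla n).2]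
  rfl

/-- APE is an operad, and it is isomorphic to the operad Brace, by an isomorphism that sends the
generator `C_n` to the corolla with `n` leaves, for every `n ≥ 1`. -/
theorem mainTheorem7 :
    APE.IsOperad ∧ Brace.IsOperad ∧
      ∃ β : OperadData.Iso Brace APE,
        ∀ n : ℕ+, β.equiv (Fin (n + 1)) (Brace.C n) = APE.Corl n :=
  ⟨FreeOperad.isOperad.of_surjective APE.evalHom fun I _ => APE.evalApp_surjective I,
    FreeOperad.isOperad.quotient braceIdeal, braceIso, evalApp_gen⟩
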